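/- Let $\alpha\in\mathbb R\setminus\{0,1\}$. For probability measures $Q,P$ on a measurable space and a measure $\nu$ with $dQ=q\,d\nu$, $dP=p\,d\nu$ (e.g. $\nu=Q+P$), the Rényi divergence is $$R_\alpha(Q\|P)=\frac{1}{\alpha(\alpha-1)}\log\int_{p>0}q^\alpha p^{1-\alpha}\,d\nu\in[0,\infty]$$ if $0<\alpha<1$, or if $\alpha>1$ and $Q\ll P$; $R_\alpha(Q\|P)=\infty$ if $\alpha>1$ and $Q\not\ll P$; and $R_\alpha(Q\|P)=R_{1-\alpha}(P\|Q)$ if $\alpha<0$. Let $X_1,X_2,\dots$ be i.i.d. with law $Q$ and $Y_1,Y_2,\dots$ be i.i.d. with law $P$, all defined on one probability space, with $n$-sample empirical measures $Q_n,P_n$. For sets $\Phi_k$ of real functions put $$\widehat R^{n,k}_\alpha(Q\|P)=\sup_{\phi\in\Phi_k}\Big\{\frac1{\alpha-1}\log\int e^{(\alpha-1)\phi}\,dQ_n-\frac1\alpha\log\int e^{\alpha\phi}\,dP_n\Big\}.$$ The estimator is called consistent if (i) when $R_\alpha(Q\|P)<\infty$, for every $\delta>0$ there is $K$ such that for all $k\ge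 K$, $\lim_{n\to\infty}\mathbb P(|R_\alpha(Q\|P)-\widehat R^{n,k}_\alpha(Q\|P)|\ge\delta)=0$; and (ii) when $R_\alpha(Q\|P)=\infty$, for every $M>0$ there is $K$ such that for all $k\ge K$, $\lim_{n\to\infty}\mathbb P(\widehat R^{n,k}_\alpha(Q\|P)\le M)=0$. A neural network on $\mathbb R^m$ is a function $B_d\circ\sigma_d\circ B_{d-1}\circ\cdots\circ\sigma_1\circ B_0$ with affine maps $B_{j}:\mathbb R^{m_{j}}\to\mathbb R^{m_{j+1}}$ ($m_0=m$, $m_{d+1}=1$), whose weights and biases are its parameters, and activations $\sigma_j:\mathbb R^{m_j}\to\mathbb R^{m_j}$; $d$ is its depth (number of hidden layers), and $m_1,\dots,m_d$ are its widths. Let $a_k$ be nondecreasing with $a_k\to\infty$. The estimator is consistent in each of the following cases. 1. $Q,P$ are Borel probability measures on a compact set $\Omega\subset\mathbb R^m$. $\Phi$ is a family of neural networks given by a set of architectures $(d;m_1,\dots,m_d;\sigma_1,\dots,\sigma_d)$ with continuous activations, finitely many of which have depth and widths below any given bound, and for each architecture a closed set of allowed parameters. $\Phi$ has the universal approximation property: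 for every $g\in C(\mathbb R^m)$, $\epsilon>0$ and compact $K\subset\mathbb R^m$ there is $\phi\in\Phi$ with $\sup_K|g-\phi|<\epsilon$. $\Phi_k$ is the set of (restrictions to $\Omega$ of) networks in $\Phi$ with depth and widths at most $k$ and all parameters in $[-a_k,a_k]$. 2. $Q,P$ are Borel probability measures on $\mathbb R^m$; $\sigma:\mathbb R\to\mathbb R$ is continuous, bounded, and injective and Lipschitz on some nonempty open interval $(c,d)$; $\Phi_k$ is the set of networks with two hidden layers of width $k$, with $\sigma$ applied componentwise and all parameters in $[-a_k,a_k]$. 3. $Q,P$ are Borel probability measures on $\mathbb R^m$ whose moment generating functions $t\mapsto\int e^{t\cdot x}dQ$, $t\mapsto\int e^{t\cdot x}dP$ are finite on all of $\mathbb R^m$ and which have Lebesgue densities bounded on compact sets; and $\Phi_k$ is one of: (a) the networks with componentwise ReLU activation, depth and widths at most $k$, and parameters in $[-a_k,a_k]$; (b) the same, but with depth exactly $3$ (and widths at most $k$); (c) the networks with GroupSort activation of group size $2$ (consecutive pairs of coordinates are sorted in ascending order; hidden widths are even), depth and widths at most $k$, and parameters in $[-a_k,a_k]$. -/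

import Mathlib

open MeasureTheory ProbabilityTheory Filter
open scoped ENNReal NNReal Topology

noncomputable section

namespace RenyiNN

section Renyi

variable {Ω : Type*} [MeasurableSpace Ω]

/-- The Rényi divergence of order `α > 0`, `α ≠ 1`, with normalization `1 / (α (α - 1))`,
computed with the dominating measure `Q + P`. Values in `[-∞, ∞]`, with `log 0 = -∞`
and `log ∞ = ∞`. -/
def renyiPos (α : ℝ) (Q P : Measure Ω) : EReal :=
  open Classical in
  if 1 < α ∧ ¬ Q ≪ P then ⊤
  else ((1 / (α * (α - 1)) : ℝ) : EReal) *
    ENNReal.log (∫⁻ x in {x | 0 < P.rnDeriv (Q + P) x},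
      (Q.rnDeriv (Q + P) x) ^ α * (P.rnDeriv (Q + P) x) ^ (1 - α) ∂(Q + P))

/-- The Rényi divergence of order `α ∈ ℝ ∖ {0, 1}`; negative orders are defined by
`R_α(Q‖P) = R_{1-α}(P‖Q)`. -/
def renyiDiv (α : ℝ) (Q P : Measure Ω) : EReal :=
  open Classical in
  if 0 < α then renyiPos α Q P else renyiPos (1 - α) P Q

/-- `1/(α-1) · log ∫ exp((α-1) φ) dQ - 1/α · log ∫ exp(α φ) dP`. Subtraction in `EReal` obeys
`∞ - ∞ = -∞ + ∞ = -∞`. -/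
def objective (α : ℝ) (Q P : Measure Ω) (φ : Ω → ℝ) : EReal :=
  (((α - 1)⁻¹ : ℝ) : EReal) *
      ENNReal.log (∫⁻ x, ENNReal.ofReal (Real.exp ((α - 1) * φ x)) ∂Q)
    - ((α⁻¹ : ℝ) : EReal) *
      ENNReal.log (∫⁻ x, ENNReal.ofReal (Real.exp (α * φ x)) ∂P)

/-- The empirical measure `(1/n) ∑_{i < n} δ_{x i}`. -/
def empiricalMeasure (x : ℕ → Ω) (n : ℕ) : Measure Ω :=
  (n : ℝ≥0∞)⁻¹ • ∑ i ∈ Finset.range n, Measure.dirac (x i)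

variable {N : Type*}

/-- The estimator: supremum over `Φ` of the objective for the empirical measures of the first
`n` samples. -/
def estimator (α : ℝ) (Φ : Set (Ω → ℝ)) (X Y : ℕ → N → Ω) (n : ℕ) (ω : N) : EReal :=
  ⨆ φ ∈ Φ, objective α (empiricalMeasure (fun i => X i ω) n)
    (empiricalMeasure (fun i => Y i ω) n) φ

/-- `X` is a sequence of iid random variables with law `Q`. -/
structure IsIIDSample [MeasurableSpace N] (X : ℕ → N → Ω) (Q : Measure Ω) (μ : Measure N) :
    Prop where
  measurable : ∀ i, Measurable (X i)
  indep : iIndepFun X μ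
  law : ∀ i, μ.map (X i) = Q

/-- Consistency of the estimators built on the spaces `Φ k`: for all large `k`, as `n → ∞`, the
estimator is within `δ` of the divergence with probability tending to one if the divergence is
finite, and exceeds `M` with probability tending to one if it is infinite. -/
def IsConsistent [MeasurableSpace N] (α : ℝ) (Q P : Measure Ω) (Φ : ℕ → Set (Ω → ℝ))
    (X Y : ℕ → N → Ω) (μ : Measure N) : Prop :=
  (renyiDiv α Q P < ⊤ → ∀ δ : ℝ, 0 < δ → ∃ K : ℕ, ∀ k ≥ K,
    Tendsto (fun n : ℕ => μ {ω | ENNReal.ofReal δ ≤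
      (renyiDiv α Q P - estimator α (Φ k) X Y n ω).abs}) atTop (𝓝 0)) ∧
  (renyiDiv α Q P = ⊤ → ∀ M : ℝ, 0 < M → ∃ K : ℕ, ∀ k ≥ K,
    Tendsto (fun n : ℕ => μ {ω | estimator α (Φ k) X Y n ω ≤ (M : EReal)}) atTop (𝓝 0))

end Renyi

/-- The architecture of a feed-forward network with input `ℝ^m` and output `ℝ`: either only the
final affine map, or a hidden layer (an affine map into `ℝ^n` followed by an activation
`σ : ℝ^n → ℝ^n`) followed by an architecture with input `ℝ^n`. -/
inductive Architecture : ℕ → Type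
  | output (m : ℕ) : Architecture m
  | hidden {m : ℕ} (n : ℕ) (σ : (Fin n → ℝ) → (Fin n → ℝ)) (rest : Architecture n) :
      Architecture m

namespace Architecture

/-- The widths of the hidden layers, from input to output. -/
def widths : {m : ℕ} → Architecture m → List ℕ
  | _, output _ => []
  | _, hidden n _ rest => n :: rest.widths

/-- The number of hidden layers. -/
def depth {m : ℕ} (A : Architecture m) : ℕ := A.widths.length

/-- Every activation in the architecture is continuous. -/
def ContinuousActivations : {m : ℕ} → Architecture m → Prop
  | _, output _ => True
  | _, hidden _ σ rest => Continuous σ ∧ rest.ContinuousActivations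

/-- The index set of the real parameters. In an affine map out of `ℝ^m`, the index `some j` is the
weight of the input coordinate `j`, and `none` is the bias. -/
def ParamIdx : {m : ℕ} → Architecture m → Type
  | m, output _ => Option (Fin m)
  | m, hidden n _ rest => (Fin n × Option (Fin m)) ⊕ rest.ParamIdx

/-- Parameter vectors (all weights and biases). -/
abbrev Params {m : ℕ} (A : Architecture m) : Type := A.ParamIdx → ℝ

/-- The function `ℝ^m → ℝ` computed by the network with given parameters. -/
def eval : {m : ℕ} → (A : Architecture m) → A.Params → (Fin m → ℝ) → ℝ
  | m, output _, θ, x =>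
      let θ' : Option (Fin m) → ℝ := θ
      (∑ j, θ' (some j) * x j) + θ' none
  | m, hidden n σ rest, θ, x =>
      let θ' : (Fin n × Option (Fin m)) ⊕ rest.ParamIdx → ℝ := θ
      rest.eval (fun i => θ' (Sum.inr i))
        (σ fun i => (∑ j, θ' (Sum.inl (i, some j)) * x j) + θ' (Sum.inl (i, none)))

/-- All parameters lie in `[-r, r]`. -/
def paramBox {m : ℕ} (A : Architecture m) (r : ℝ) : Set A.Params :=
  {θ | ∀ i, θ i ∈ Set.Icc (-r) r}

/-- The architecture with hidden widths `ws` in which a layer of width `n` has activation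
`act n`. -/
def uniform (act : (n : ℕ) → (Fin n → ℝ) → (Fin n → ℝ)) : (m : ℕ) → List ℕ → Architecture m
  | m, [] => output m
  | _, n :: ws => hidden n (act n) (uniform act n ws)

end Architecture

/-- A family of neural networks: a set of architectures with continuous activations, and for each
of them a closed set of allowed parameters. Activations are part of the architecture and are not
trained, so only finitely many architectures have depth and widths below a given bound. -/
structure NetworkFamily (m : ℕ) where
  archs : Set (Architecture m)
  params : (A : Architecture m) → Set A.Params
  continuous_activations : ∀ A ∈ archs, A.ContinuousActivations
  isClosed_params : ∀ A ∈ archs, IsClosed (params A)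
  finite_archs : ∀ k : ℕ, {A ∈ archs | A.depth ≤ k ∧ ∀ w ∈ A.widths, w ≤ k}.Finite

namespace NetworkFamily

variable {m : ℕ}

/-- The set of functions computed by the networks of the family. -/
def functions (F : NetworkFamily m) : Set ((Fin m → ℝ) → ℝ) :=
  {φ | ∃ A ∈ F.archs, ∃ θ ∈ F.params A, φ = A.eval θ}

/-- The functions computed by networks of the family with depth and widths at most `k` and
parameters in `[-r, r]`. -/
def bounded (F : NetworkFamily m) (k : ℕ) (r : ℝ) : Set ((Fin m → ℝ) → ℝ) :=
  {φ | ∃ A ∈ F.archs, A.depth ≤ k ∧ (∀ w ∈ A.widths, w ≤ k) ∧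
    ∃ θ ∈ F.params A ∩ A.paramBox r, φ = A.eval θ}

end NetworkFamily

/-- The universal approximation property: uniform approximation on compact sets of every
continuous function on `ℝ^m`. -/
def UniversalApproximation {m : ℕ} (Φ : Set ((Fin m → ℝ) → ℝ)) : Prop :=
  ∀ g : (Fin m → ℝ) → ℝ, Continuous g → ∀ ε : ℝ, 0 < ε →
    ∀ K : Set (Fin m → ℝ), IsCompact K → ∃ φ ∈ Φ, ∀ x ∈ K, |g x - φ x| < ε

/-- The componentwise activation given by `σ : ℝ → ℝ`. -/
def componentwise (σ : ℝ → ℝ) (n : ℕ) (x : Fin n → ℝ) : Fin n → ℝ := fun i => σ (x i)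

/-- The ReLU function. -/
def relu (t : ℝ) : ℝ := max t 0

/-- GroupSort with group size 2: each pair of coordinates `(2i, 2i+1)` is sorted in ascending order.
(It is used only for even `n`; for odd `n` this formula leaves the last coordinate unchanged.) -/
def groupSort (n : ℕ) (x : Fin n → ℝ) : Fin n → ℝ := fun i =>
  if (i : ℕ) % 2 = 0 then
    if h : (i : ℕ) + 1 < n then min (x i) (x ⟨i + 1, h⟩) else x i
  else max (x ⟨(i : ℕ) - 1, lt_of_le_of_lt (Nat.sub_le _ _) i.isLt⟩) (x i)

/-- The functions computed by networks on `ℝ^m` with activations `act`, list of hidden widths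
in `W`, and parameters in `[-r, r]`. -/
def networks (m : ℕ) (act : (n : ℕ) → (Fin n → ℝ) → (Fin n → ℝ)) (W : Set (List ℕ)) (r : ℝ) :
    Set ((Fin m → ℝ) → ℝ) :=
  {φ | ∃ ws ∈ W, ∃ θ ∈ (Architecture.uniform act m ws).paramBox r,
    φ = (Architecture.uniform act m ws).eval θ}

/-- The moment generating function of `Q` is finite everywhere. -/
def FiniteMGF {m : ℕ} (Q : Measure (Fin m → ℝ)) : Prop :=
  ∀ t : Fin m → ℝ, Integrable (fun x => Real.exp (t ⬝ᵥ x)) Q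

/-- `Q` has a Lebesgue density that is bounded on compact sets. -/
def HasLocallyBoundedDensity {m : ℕ} (Q : Measure (Fin m → ℝ)) : Prop :=
  ∃ q : (Fin m → ℝ) → ℝ≥0, Measurable q ∧ Q = volume.withDensity (fun x => (q x : ℝ≥0∞)) ∧
    ∀ K : Set (Fin m → ℝ), IsCompact K → ∃ C : ℝ≥0, ∀ x ∈ K, q x ≤ C

end RenyiNN

end

/-!
The Rényi divergence is the supremum of the objective
`(α - 1)⁻¹ log ∫ exp((α - 1) φ) dQ - α⁻¹ log ∫ exp(α φ) dP` over bounded functions `φ`, and a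
network estimator is consistent as soon as its spaces `Φ k` give empirical objectives uniformly
close to the true ones, for each `k` and as `n → ∞`, and eventually contain nearly optimal
functions.

*Variational formula.* With densities `q + p = 1` with respect to `Q + P`, the divergence is
`1 / (α (α - 1))` times the logarithm of the Hellinger integral `∫ q^α p^(1-α)`
(`renyiPos_eq_log_hellinger`). Hölder's inequality bounds the objective by the divergence
(`objective_le_renyiDiv`). The formal maximizer is `log (q / p)`; its truncations
`log ((q ∨ s) / (p ∨ s))`, with `s → 0`, are bounded and their objectives converge to the
divergence, by dominated convergence when the Hellinger integral is finite and by Fatou's lemma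
when it is not (`exists_bounded_lt_objective`). Negative orders reduce to orders above one by the
symmetry `α ↦ 1 - α`, `Q ↔ P`, `φ ↦ -φ` (`objective_swap`).

*Reduction to single functions.* Only the bound from above has to be uniform in `φ`. For a fixed
`k` the parameters range over finitely many compact sets, and `θ ↦ exp(c φ_θ(X_i))` are integrable
i.i.d. random elements of the separable Banach space `C(Θ, ℝ)`. The strong law in that space makes
the empirical objectives uniformly close to the true ones, which never exceed the divergence
(`tendsto_measure_exists_lt_abs_average_sub`, `upperBoundInProbability_of_compact`). The bound from
below, as well as the whole case of an infinite divergence, needs only the law of large numbers for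
one bounded nearly optimal function lying in `Φ k` for all large `k`
(`isConsistent_of_boundedlyDense`). Such a function exists if continuous bounded functions can be
approximated on compact sets by globally bounded members of the spaces, since the objective is
`L¹`-continuous on uniformly bounded sets (`exists_forall_lt_objective`) and finite measures are
tight (`boundedlyDense_of_compact_approximation`).

*Bounded approximation by networks.* On a compact domain this is the universal approximation
property. On `ℝ^m` one hidden layer with a bounded continuous nonconstant activation is dense on
compact sets (`exists_shallow_close`): after mollification, differentiating `f(t (w · x) + b)` in
`t` yields all powers of `w · x`, hence the exponentials `exp(w · x)`, and the Stone–Weierstrass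
theorem applies. A further layer makes the approximation globally bounded: `A σ(h) + D` for an
activation `σ` that is bounded and injective on an interval (`boundedlyDense_networks_two`), and
the clamping `relu(relu(t + B) - relu(t - B)) - B` for ReLU (`eventually_clamp_mem_networks_relu`),
which GroupSort simulates with pairs of units one of which is zero
(`eventually_clamp_mem_networks_groupSort`). For the unbounded activations the exponential
envelopes are integrable because networks grow linearly and the moment generating functions are
finite.
-/

noncomputable section

namespace RenyiNN

/-! ### The Rényi divergence as a logarithmic Hellinger integral -/

section Hellinger

variable {E : Type*} [MeasurableSpace E]

/-- The Hellinger integral `∫ q^α p^(1-α) d(Q + P)`, over the whole space. Where `p = 0` the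
`ℝ≥0∞` conventions give the integrand the value `0` if `α < 1` and `∞` if `α > 1`. -/
def hellinger (α : ℝ) (Q P : Measure E) : ℝ≥0∞ :=
  ∫⁻ x, (Q.rnDeriv (Q + P) x) ^ α * (P.rnDeriv (Q + P) x) ^ (1 - α) ∂(Q + P)

lemma absolutelyContinuous_add_left (Q P : Measure E) : Q ≪ Q + P :=
  Measure.absolutelyContinuous_of_le (Measure.le_add_right le_rfl)

lemma absolutelyContinuous_add_right (Q P : Measure E) : P ≪ Q + P :=
  Measure.absolutelyContinuous_of_le (Measure.le_add_left le_rfl)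

/-- Densities of `Q` and `P` with respect to `Q + P` that sum to `1` at every point. -/
lemma exists_densities (Q P : Measure E) [IsProbabilityMeasure Q] [IsProbabilityMeasure P] :
    ∃ q p : E → ℝ≥0∞, Measurable q ∧ Measurable p ∧ (∀ x, q x + p x = 1) ∧
      Q.rnDeriv (Q + P) =ᵐ[Q + P] q ∧ P.rnDeriv (Q + P) =ᵐ[Q + P] p := by
  have hsum : ∀ᵐ x ∂(Q + P), Q.rnDeriv (Q + P) x + P.rnDeriv (Q + P) x = 1 := by
    filter_upwards [Measure.rnDeriv_add Q P (Q + P), Measure.rnDeriv_self (Q + P)] with x h1 h2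
    rw [h1] at h2
    exact h2
  have hq : Measurable (fun x => min (Q.rnDeriv (Q + P) x) 1) :=
    (Measure.measurable_rnDeriv _ _).min measurable_const
  refine ⟨fun x => min (Q.rnDeriv (Q + P) x) 1, fun x => 1 - min (Q.rnDeriv (Q + P) x) 1,
    hq, measurable_const.sub hq, fun x => add_tsub_cancel_of_le (min_le_right _ _), ?_, ?_⟩
  · filter_upwards [hsum] with x hx
    rw [min_eq_left]
    exact hx ▸ le_self_add
  · filter_upwards [hsum] with x hx
    have h1 : Q.rnDeriv (Q + P) x ≤ 1 := hx ▸ le_self_add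
    rw [min_eq_left h1]
    exact ENNReal.eq_sub_of_add_eq' ENNReal.one_ne_top (by rw [add_comm]; exact hx)

lemma lintegral_eq_lintegral_density {Q ν : Measure E} [IsFiniteMeasure Q] [IsFiniteMeasure ν]
    (hac : Q ≪ ν) {q : E → ℝ≥0∞} (hq : Q.rnDeriv ν =ᵐ[ν] q) {f : E → ℝ≥0∞} (hf : Measurable f) :
    ∫⁻ x, f x ∂Q = ∫⁻ x, q x * f x ∂ν := by
  rw [← lintegral_rnDeriv_mul hac hf.aemeasurable]
  refine lintegral_congr_ae ?_
  filter_upwards [hq] with x hx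
  rw [hx]

lemma hellinger_eq {α : ℝ} {Q P : Measure E} {q p : E → ℝ≥0∞}
    (hq : Q.rnDeriv (Q + P) =ᵐ[Q + P] q) (hp : P.rnDeriv (Q + P) =ᵐ[Q + P] p) :
    hellinger α Q P = ∫⁻ x, q x ^ α * p x ^ (1 - α) ∂(Q + P) := by
  refine lintegral_congr_ae ?_
  filter_upwards [hq, hp] with x h1 h2
  rw [h1, h2]

lemma pos_rnDeriv_ae_of_absolutelyContinuous {Q P : Measure E} [IsProbabilityMeasure Q]
    [IsProbabilityMeasure P] (h : Q ≪ P) : ∀ᵐ x ∂(Q + P), 0 < P.rnDeriv (Q + P) x := by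
  have hP := Measure.rnDeriv_pos (absolutelyContinuous_add_right Q P)
  exact (Measure.AbsolutelyContinuous.add_left_iff.2 ⟨h, Measure.AbsolutelyContinuous.rfl⟩).ae_le hP

lemma renyiPos_eq_log_hellinger {α : ℝ} (hα0 : 0 < α) (hα1 : α ≠ 1) (Q P : Measure E)
    [IsProbabilityMeasure Q] [IsProbabilityMeasure P] :
    renyiPos α Q P = ((1 / (α * (α - 1)) : ℝ) : EReal) * ENNReal.log (hellinger α Q P) := by
  have hms : MeasurableSet {x | 0 < P.rnDeriv (Q + P) x} :=
    measurableSet_lt measurable_const (Measure.measurable_rnDeriv _ _)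
  unfold renyiPos
  split_ifs with h
  · -- the set where `p = 0` has positive measure and carries an infinite integrand
    obtain ⟨h1, hac⟩ := h
    have hc : 0 < 1 / (α * (α - 1)) := by
      have : 0 < α - 1 := by linarith
      positivity
    have htop : hellinger α Q P = ⊤ := by
      obtain ⟨q, p, hqm, hpm, hqp, hq, hp⟩ := exists_densities Q P
      rw [hellinger_eq hq hp]
      by_contra hne
      have hfin : ∀ᵐ x ∂(Q + P), q x ^ α * p x ^ (1 - α) < ⊤ :=
        ae_lt_top (by fun_prop) hne
      refine hac (Measure.AbsolutelyContinuous.mk fun s hs hPs => ?_)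
      have hPs' : ∀ᵐ x ∂(Q + P), x ∈ s → p x = 0 := by
        have h2 := lintegral_eq_lintegral_density (absolutelyContinuous_add_right Q P) hp
          (f := s.indicator 1) (measurable_one.indicator hs)
        rw [lintegral_indicator_one hs, hPs] at h2
        have h3 := (lintegral_eq_zero_iff (hpm.mul (measurable_one.indicator hs))).1 h2.symm
        filter_upwards [h3] with x hx hxs
        simpa [hxs] using hx
      have hnot : ∀ᵐ x ∂(Q + P), x ∉ s := by
        filter_upwards [hfin, hPs'] with x hx hxs hmem
        have hp0 := hxs hmem
        have hq1 : q x = 1 := by have := hqp x; rwa [hp0, add_zero] at this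
        rw [hp0, hq1, ENNReal.one_rpow, ENNReal.zero_rpow_of_neg (by linarith)] at hx
        simp at hx
      have := (absolutelyContinuous_add_left Q P).ae_le hnot
      exact measure_eq_zero_iff_ae_notMem.2 this
    rw [htop, ENNReal.log_top, EReal.coe_mul_top_of_pos hc]
  · congr 2
    unfold hellinger
    by_cases h1 : 1 < α
    · have hac : Q ≪ P := by
        by_contra hn
        exact h ⟨h1, hn⟩
      rw [Measure.restrict_eq_self_of_ae_mem
        (s := {x | 0 < P.rnDeriv (Q + P) x}) (pos_rnDeriv_ae_of_absolutelyContinuous hac)]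
    · have h1' : 0 < 1 - α := by
        rcases lt_or_gt_of_ne hα1 with h2 | h2
        · linarith
        · exact absurd h2 h1
      rw [← lintegral_indicator hms]
      refine lintegral_congr fun x => ?_
      by_cases hx : 0 < P.rnDeriv (Q + P) x
      · rw [Set.indicator_of_mem (show x ∈ {x | 0 < P.rnDeriv (Q + P) x} from hx)]
      · rw [Set.indicator_of_notMem (show x ∉ {x | 0 < P.rnDeriv (Q + P) x} from hx)]
        have : P.rnDeriv (Q + P) x = 0 := by simpa using hx
        rw [this, ENNReal.zero_rpow_of_pos h1', mul_zero]

end Hellinger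

/-! ### The variational upper bound -/

section UpperBound

variable {E : Type*} [MeasurableSpace E]

/-- The value of the objective in terms of the two exponential moments `u = ∫ exp((α-1)φ) dQ`
and `v = ∫ exp(αφ) dP`. -/
def objectiveValue (α u v : ℝ) : ℝ := (α - 1)⁻¹ * Real.log u - α⁻¹ * Real.log v

lemma objective_eq_coe {α : ℝ} {Q P : Measure E} {φ : E → ℝ} {u v : ℝ} (hu : 0 < u) (hv : 0 < v)
    (hU : ∫⁻ x, ENNReal.ofReal (Real.exp ((α - 1) * φ x)) ∂Q = ENNReal.ofReal u)
    (hV : ∫⁻ x, ENNReal.ofReal (Real.exp (α * φ x)) ∂P = ENNReal.ofReal v) :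
    objective α Q P φ = (objectiveValue α u v : EReal) := by
  unfold objective objectiveValue
  rw [hU, hV, ENNReal.log_ofReal_of_pos hu, ENNReal.log_ofReal_of_pos hv]
  norm_cast

lemma objective_eq_coe_integral {α : ℝ} {Q P : Measure E} [IsProbabilityMeasure Q]
    [IsProbabilityMeasure P] {φ : E → ℝ}
    (hQ : Integrable (fun x => Real.exp ((α - 1) * φ x)) Q)
    (hP : Integrable (fun x => Real.exp (α * φ x)) P) :
    objective α Q P φ = (objectiveValue α (∫ x, Real.exp ((α - 1) * φ x) ∂Q)
      (∫ x, Real.exp (α * φ x) ∂P) : EReal) :=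
  objective_eq_coe (integral_exp_pos hQ) (integral_exp_pos hP)
    (ofReal_integral_eq_lintegral_ofReal hQ (ae_of_all _ fun _ => (Real.exp_pos _).le)).symm
    (ofReal_integral_eq_lintegral_ofReal hP (ae_of_all _ fun _ => (Real.exp_pos _).le)).symm

/-- The variational functional is symmetric under `α ↦ 1 - α`, `Q ↔ P`, `φ ↦ -φ`. -/
lemma objectiveValue_swap (α u v : ℝ) : objectiveValue (1 - α) v u = objectiveValue α u v := by
  unfold objectiveValue
  rw [show (1 - α - 1) = -α by ring, show (1 - α) = -(α - 1) by ring, inv_neg, inv_neg]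
  ring

lemma objective_swap {α : ℝ} {Q P : Measure E} [IsProbabilityMeasure Q]
    [IsProbabilityMeasure P] {φ : E → ℝ}
    (hQ : Integrable (fun x => Real.exp ((α - 1) * φ x)) Q)
    (hP : Integrable (fun x => Real.exp (α * φ x)) P) :
    objective (1 - α) P Q (fun x => -φ x) = objective α Q P φ := by
  have e1 : (fun x => Real.exp ((1 - α - 1) * -φ x)) = fun x => Real.exp (α * φ x) := by
    funext x; congr 1; ring
  have e2 : (fun x => Real.exp ((1 - α) * -φ x)) = fun x => Real.exp ((α - 1) * φ x) := by
    funext x; congr 1; ring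
  rw [objective_eq_coe_integral hQ hP, objective_eq_coe_integral (by rwa [e1]) (by rwa [e2]),
    e1, e2, objectiveValue_swap]

/-- The form in which Hölder's inequality bounds the objective by the divergence when `α < 1`. -/
lemma hellinger_le_of_lt_one {α : ℝ} (hα0 : 0 < α) (hα1 : α < 1) {Q P : Measure E}
    [IsProbabilityMeasure Q] [IsProbabilityMeasure P] {φ : E → ℝ} (hφ : Measurable φ) :
    hellinger α Q P ≤ (∫⁻ x, ENNReal.ofReal (Real.exp ((α - 1) * φ x)) ∂Q) ^ α *
      (∫⁻ x, ENNReal.ofReal (Real.exp (α * φ x)) ∂P) ^ (1 - α) := by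
  obtain ⟨q, p, hqm, hpm, hqp, hq, hp⟩ := exists_densities Q P
  rw [hellinger_eq hq hp,
    lintegral_eq_lintegral_density (absolutelyContinuous_add_left Q P) hq (by fun_prop),
    lintegral_eq_lintegral_density (absolutelyContinuous_add_right Q P) hp (by fun_prop)]
  refine le_trans (le_of_eq ?_) (ENNReal.lintegral_mul_norm_pow_le (p := α) (q := 1 - α)
    (by fun_prop) (by fun_prop) hα0.le (by linarith) (by ring))
  refine lintegral_congr fun x => ?_
  rw [ENNReal.mul_rpow_of_nonneg _ _ hα0.le,
    ENNReal.mul_rpow_of_nonneg _ _ (by linarith : 0 ≤ 1 - α),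
    mul_mul_mul_comm]
  have : ENNReal.ofReal (Real.exp ((α - 1) * φ x)) ^ α *
      ENNReal.ofReal (Real.exp (α * φ x)) ^ (1 - α) = 1 := by
    rw [ENNReal.ofReal_rpow_of_pos (Real.exp_pos _), ENNReal.ofReal_rpow_of_pos (Real.exp_pos _),
      ← ENNReal.ofReal_mul (by positivity), ← Real.exp_mul, ← Real.exp_mul, ← Real.exp_add,
      ← ENNReal.ofReal_one, ← Real.exp_zero]
    congr 2; ring
  rw [this, mul_one]

/-- The form in which Hölder's inequality bounds the objective by the divergence when `α > 1`. -/
lemma lintegral_exp_le_of_one_lt {α : ℝ} (hα1 : 1 < α) {Q P : Measure E}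
    [IsProbabilityMeasure Q] [IsProbabilityMeasure P] {φ : E → ℝ} (hφ : Measurable φ)
    (hfin : hellinger α Q P ≠ ⊤) :
    ∫⁻ x, ENNReal.ofReal (Real.exp ((α - 1) * φ x)) ∂Q ≤
      (hellinger α Q P) ^ α⁻¹ *
        (∫⁻ x, ENNReal.ofReal (Real.exp (α * φ x)) ∂P) ^ (1 - α⁻¹) := by
  have hα0 : 0 < α := by linarith
  obtain ⟨q, p, hqm, hpm, hqp, hq, hp⟩ := exists_densities Q P
  rw [hellinger_eq hq hp] at hfin ⊢
  rw [lintegral_eq_lintegral_density (absolutelyContinuous_add_left Q P) hq (by fun_prop),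
    lintegral_eq_lintegral_density (absolutelyContinuous_add_right Q P) hp (by fun_prop)]
  have hinv : 0 ≤ 1 - α⁻¹ := by
    have := inv_le_one_of_one_le₀ hα1.le
    linarith
  refine le_trans (le_of_eq ?_) (ENNReal.lintegral_mul_norm_pow_le (p := α⁻¹) (q := 1 - α⁻¹)
    (by fun_prop) (by fun_prop) (by positivity) hinv (by ring))
  refine lintegral_congr_ae ?_
  filter_upwards [ae_lt_top (by fun_prop) hfin] with x hx
  have hp1 : p x ≠ ⊤ := ne_top_of_le_ne_top ENNReal.one_ne_top (hqp x ▸ le_add_self)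
  have hp0 : p x ≠ 0 := by
    intro h0
    have hq1 : q x = 1 := by have := hqp x; rwa [h0, add_zero] at this
    rw [h0, hq1, ENNReal.one_rpow, ENNReal.zero_rpow_of_neg (by linarith)] at hx
    simp at hx
  rw [ENNReal.mul_rpow_of_nonneg _ _ hinv, ENNReal.mul_rpow_of_nonneg _ _ (by positivity : 0 ≤ α⁻¹),
    ← ENNReal.rpow_mul, ← ENNReal.rpow_mul, mul_inv_cancel₀ hα0.ne', ENNReal.rpow_one,
    mul_mul_mul_comm, mul_assoc]
  rw [show q x * (p x ^ (1 - α⁻¹) * (p x ^ ((1 - α) * α⁻¹) *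
      ENNReal.ofReal (Real.exp (α * φ x)) ^ (1 - α⁻¹))) =
      q x * ((p x ^ ((1 - α) * α⁻¹) * p x ^ (1 - α⁻¹)) *
      ENNReal.ofReal (Real.exp (α * φ x)) ^ (1 - α⁻¹)) by ring]
  rw [← ENNReal.rpow_add _ _ hp0 hp1, show (1 - α) * α⁻¹ + (1 - α⁻¹) = 0 by field_simp; ring,
    ENNReal.rpow_zero, one_mul, ENNReal.ofReal_rpow_of_pos (Real.exp_pos _), ← Real.exp_mul]
  congr 3
  field_simp

/-- The variational upper bound: the objective never exceeds the divergence. -/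
lemma objective_le_renyiPos {α : ℝ} (hα0 : 0 < α) (hα1 : α ≠ 1) {Q P : Measure E}
    [IsProbabilityMeasure Q] [IsProbabilityMeasure P] {φ : E → ℝ} (hφ : Measurable φ)
    (hQ : Integrable (fun x => Real.exp ((α - 1) * φ x)) Q)
    (hP : Integrable (fun x => Real.exp (α * φ x)) P) :
    objective α Q P φ ≤ renyiPos α Q P := by
  rw [objective_eq_coe_integral hQ hP, renyiPos_eq_log_hellinger hα0 hα1]
  have hU := (ofReal_integral_eq_lintegral_ofReal hQ (ae_of_all _ fun _ => (Real.exp_pos _).le))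
  have hV := (ofReal_integral_eq_lintegral_ofReal hP (ae_of_all _ fun _ => (Real.exp_pos _).le))
  have hu : 0 < ∫ x, Real.exp ((α - 1) * φ x) ∂Q := integral_exp_pos hQ
  have hv : 0 < ∫ x, Real.exp (α * φ x) ∂P := integral_exp_pos hP
  set u := ∫ x, Real.exp ((α - 1) * φ x) ∂Q
  set v := ∫ x, Real.exp (α * φ x) ∂P
  rcases lt_or_gt_of_ne hα1 with h1 | h1
  · have hc : 1 / (α * (α - 1)) < 0 := one_div_neg.2 (mul_neg_of_pos_of_neg hα0 (by linarith))
    have hle := hellinger_le_of_lt_one hα0 h1 (Q := Q) (P := P) hφ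
    rw [← hU, ← hV, ENNReal.ofReal_rpow_of_pos hu, ENNReal.ofReal_rpow_of_pos hv,
      ← ENNReal.ofReal_mul (by positivity)] at hle
    rcases eq_or_ne (hellinger α Q P) 0 with h0 | h0
    · rw [h0, ENNReal.log_zero, EReal.coe_mul_bot_of_neg hc]
      exact le_top
    · have hne : hellinger α Q P ≠ ⊤ := ne_top_of_le_ne_top ENNReal.ofReal_ne_top hle
      have hj := ENNReal.toReal_pos h0 hne
      rw [← ENNReal.ofReal_toReal hne] at hle ⊢
      set j := (hellinger α Q P).toReal
      rw [ENNReal.log_ofReal_of_pos hj]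
      rw [ENNReal.ofReal_le_ofReal_iff (by positivity)] at hle
      have hlog := Real.log_le_log hj hle
      rw [Real.log_mul (by positivity) (by positivity), Real.log_rpow hu, Real.log_rpow hv] at hlog
      norm_cast
      unfold objectiveValue
      have h2 := mul_le_mul_of_nonpos_left hlog hc.le
      refine le_trans (le_of_eq ?_) h2
      have : α - 1 ≠ 0 := by linarith
      field_simp
      ring
  · have hc : 0 < 1 / (α * (α - 1)) := one_div_pos.2 (mul_pos hα0 (by linarith))
    rcases eq_or_ne (hellinger α Q P) ⊤ with h0 | h0
    · rw [h0, ENNReal.log_top, EReal.coe_mul_top_of_pos hc]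
      exact le_top
    · have hle := lintegral_exp_le_of_one_lt h1 (Q := Q) (P := P) hφ h0
      rw [← hU, ← hV] at hle
      have hj : 0 < (hellinger α Q P).toReal := by
        refine ENNReal.toReal_pos (fun hz => ?_) h0
        rw [hz, ENNReal.zero_rpow_of_pos (by positivity), zero_mul] at hle
        simp only [nonpos_iff_eq_zero, ENNReal.ofReal_eq_zero] at hle
        linarith
      rw [← ENNReal.ofReal_toReal h0] at hle ⊢
      set j := (hellinger α Q P).toReal
      rw [ENNReal.ofReal_rpow_of_pos hj, ENNReal.ofReal_rpow_of_pos hv,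
        ← ENNReal.ofReal_mul (by positivity), ENNReal.ofReal_le_ofReal_iff (by positivity)] at hle
      rw [ENNReal.log_ofReal_of_pos hj]
      have hlog := Real.log_le_log hu hle
      rw [Real.log_mul (by positivity) (by positivity), Real.log_rpow hj, Real.log_rpow hv] at hlog
      norm_cast
      unfold objectiveValue
      have h3 : 0 < α - 1 := by linarith
      have h2 := mul_le_mul_of_nonneg_left hlog (inv_pos.2 h3).le
      have h4 : (α - 1)⁻¹ * (α⁻¹ * Real.log j + (1 - α⁻¹) * Real.log v) =
          1 / (α * (α - 1)) * Real.log j + α⁻¹ * Real.log v := by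
        field_simp
      linarith

end UpperBound

/-! ### Attaining the divergence by bounded functions -/

section LowerBound

/-- The factor `(q ∨ s)^α (p ∨ s)^(1-α)` regularizing the Hellinger integrand `q^α p^(1-α)`. -/
def hellingerReg (α : ℝ) (q p s : ℝ≥0∞) : ℝ≥0∞ := max q s ^ α * max p s ^ (1 - α)

/-- The `Q`-integrand `q ((q ∨ s)/(p ∨ s))^(α-1)`, written without division. -/
def tiltLeft (α : ℝ) (q p s : ℝ≥0∞) : ℝ≥0∞ := q * (max q s ^ (α - 1) * max p s ^ (1 - α))

/-- The `P`-integrand `p ((q ∨ s)/(p ∨ s))^α`, written without division. -/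
def tiltRight (α : ℝ) (q p s : ℝ≥0∞) : ℝ≥0∞ := p * (max q s ^ α * max p s ^ (-α))

variable {α : ℝ} {q p s : ℝ≥0∞}

lemma mul_rpow_sub_one (hq0 : q ≠ 0) (hq1 : q ≠ ⊤) (a : ℝ) : q * q ^ (a - 1) = q ^ a := by
  conv_lhs => rw [← ENNReal.rpow_one q, ← ENNReal.rpow_mul, one_mul, ← ENNReal.rpow_add _ _ hq0 hq1]
  congr 1; ring

lemma tiltLeft_eq_of_le (hs : s ≠ 0) (hq : q ≠ ⊤) (h : s ≤ q) :
    tiltLeft α q p s = hellingerReg α q p s := by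
  have hq0 : q ≠ 0 := (lt_of_lt_of_le (pos_iff_ne_zero.2 hs) h).ne'
  unfold tiltLeft hellingerReg
  rw [max_eq_left h, ← mul_assoc, mul_rpow_sub_one hq0 hq]

lemma tiltRight_eq_of_le (hs : s ≠ 0) (hp : p ≠ ⊤) (h : s ≤ p) :
    tiltRight α q p s = hellingerReg α q p s := by
  have hp0 : p ≠ 0 := (lt_of_lt_of_le (pos_iff_ne_zero.2 hs) h).ne'
  unfold tiltRight hellingerReg
  rw [max_eq_left h, mul_left_comm]
  congr 1
  rw [show -α = (1 - α) - 1 by ring, mul_rpow_sub_one hp0 hp]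

lemma tiltLeft_le (hs : s ≠ 0) (hs1 : s ≠ ⊤) (hq : q ≠ ⊤) :
    tiltLeft α q p s ≤ hellingerReg α q p s := by
  unfold tiltLeft hellingerReg
  rw [← mul_assoc]
  gcongr
  rw [← mul_rpow_sub_one (q := max q s) (a := α)
    (lt_of_lt_of_le (pos_iff_ne_zero.2 hs) (le_max_right _ _)).ne'
    (by simp [hq, hs1])]
  gcongr
  exact le_max_left _ _

lemma tiltRight_le (hs : s ≠ 0) (hs1 : s ≠ ⊤) (hp : p ≠ ⊤) :
    tiltRight α q p s ≤ hellingerReg α q p s := by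
  unfold tiltRight hellingerReg
  rw [mul_left_comm]
  gcongr
  rw [show -α = (1 - α) - 1 by ring, ← mul_rpow_sub_one (q := max p s) (a := 1 - α)
    (lt_of_lt_of_le (pos_iff_ne_zero.2 hs) (le_max_right _ _)).ne' (by simp [hp, hs1])]
  gcongr
  exact le_max_left _ _

lemma half_le_of_add_eq_one (hqp : q + p = 1) (h : q < 1 / 2) : 1 / 2 ≤ p := by
  by_contra hlt
  have := ENNReal.add_lt_add h (not_le.1 hlt)
  rw [hqp, ENNReal.add_halves] at this
  exact lt_irrefl _ this

/-- When `q < s`, the mass of `q + p = 1` sits on `p`, and the regularized integrand is small. -/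
lemma hellingerReg_le_one_of_lt (hα : 0 < α) (hqp : q + p = 1) (hs : s ≠ 0) (hs2 : s ≤ 1 / 2)
    (h : q < s) : hellingerReg α q p s ≤ 1 := by
  have hp : 1 / 2 ≤ p := half_le_of_add_eq_one hqp (h.trans_le hs2)
  have hsp : s ≤ p := hs2.trans hp
  have hp1 : p ≤ 1 := hqp ▸ le_add_self
  have hp0 : p ≠ 0 := (lt_of_lt_of_le (pos_iff_ne_zero.2 hs) hsp).ne'
  unfold hellingerReg
  rw [max_eq_right h.le, max_eq_left hsp]
  calc s ^ α * p ^ (1 - α) ≤ p ^ α * p ^ (1 - α) := by gcongr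
    _ = p := by
      rw [← ENNReal.rpow_add _ _ hp0 (ne_top_of_le_ne_top ENNReal.one_ne_top hp1)]
      simp
    _ ≤ 1 := hp1

lemma hellingerReg_le (hα : 0 < α) (hqp : q + p = 1) (hs : s ≠ 0) (hs2 : s ≤ 1 / 2) :
    hellingerReg α q p s ≤ q ^ α * p ^ (1 - α) + 1 := by
  have hq1 : q ≤ 1 := hqp ▸ le_self_add
  have hp1 : p ≤ 1 := hqp ▸ le_add_self
  have hs1 : s ≤ 1 := hs2.trans (by simp)
  rcases lt_or_ge q s with h | h
  · exact (hellingerReg_le_one_of_lt hα hqp hs hs2 h).trans le_add_self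
  rcases le_or_gt α 1 with hα1 | hα1
  · refine le_trans ?_ le_add_self
    unfold hellingerReg
    exact mul_le_one' (ENNReal.rpow_le_one (max_le hq1 hs1) hα.le)
      (ENNReal.rpow_le_one (max_le hp1 hs1) (by linarith))
  · refine le_trans ?_ le_self_add
    unfold hellingerReg
    rw [max_eq_left h]
    gcongr 1
    rw [show 1 - α = -(α - 1) by ring, ENNReal.rpow_neg, ENNReal.rpow_neg, ENNReal.inv_le_inv]
    exact ENNReal.rpow_le_rpow (le_max_left _ _) (by linarith)

lemma hellingerReg_le_tiltLeft_add_one (hα : 0 < α) (hqp : q + p = 1) (hs : s ≠ 0)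
    (hs2 : s ≤ 1 / 2) : hellingerReg α q p s ≤ tiltLeft α q p s + 1 := by
  have hq1 : q ≤ 1 := hqp ▸ le_self_add
  rcases lt_or_ge q s with h | h
  · exact (hellingerReg_le_one_of_lt hα hqp hs hs2 h).trans le_add_self
  · rw [tiltLeft_eq_of_le hs (ne_top_of_le_ne_top ENNReal.one_ne_top hq1) h]
    exact le_self_add

lemma tendsto_max_rpow {S : ℕ → ℝ≥0∞} (hS : Tendsto S atTop (𝓝 0)) (q : ℝ≥0∞) (a : ℝ) :
    Tendsto (fun n => max q (S n) ^ a) atTop (𝓝 (q ^ a)) := by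
  refine (ENNReal.continuous_rpow_const.tendsto q).comp ?_
  have := (tendsto_const_nhds (x := q)).max hS
  simpa using this

lemma tendsto_tiltLeft {S : ℕ → ℝ≥0∞} (hS : Tendsto S atTop (𝓝 0)) (hS0 : ∀ n, S n ≠ 0)
    (hα : 0 < α) (hqp : q + p = 1) :
    Tendsto (fun n => tiltLeft α q p (S n)) atTop (𝓝 (q ^ α * p ^ (1 - α))) := by
  have hq1 : q ≤ 1 := hqp ▸ le_self_add
  have hqt : q ≠ ⊤ := ne_top_of_le_ne_top ENNReal.one_ne_top hq1
  rcases eq_or_ne q 0 with h0 | h0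
  · subst h0
    simp [tiltLeft, ENNReal.zero_rpow_of_pos hα]
  · have hev : ∀ᶠ n in atTop, hellingerReg α q p (S n) = tiltLeft α q p (S n) := by
      filter_upwards [hS.eventually_lt_const (pos_iff_ne_zero.2 h0)] with n hn
      rw [tiltLeft_eq_of_le (hS0 n) hqt hn.le]
    refine Tendsto.congr' hev ?_
    refine ENNReal.Tendsto.mul (tendsto_max_rpow hS q α) (Or.inl ?_)
      (tendsto_max_rpow hS p (1 - α)) (Or.inr ?_)
    · simp [h0, hqt, hα.not_gt]
    · exact ENNReal.rpow_ne_top_of_nonneg hα.le hqt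

lemma tendsto_tiltRight {S : ℕ → ℝ≥0∞} (hS : Tendsto S atTop (𝓝 0)) (hS0 : ∀ n, S n ≠ 0)
    (hα : 0 < α) (hα1 : α ≠ 1) (hqp : q + p = 1) (hfin : q ^ α * p ^ (1 - α) ≠ ⊤) :
    Tendsto (fun n => tiltRight α q p (S n)) atTop (𝓝 (q ^ α * p ^ (1 - α))) := by
  have hp1 : p ≤ 1 := hqp ▸ le_add_self
  have hpt : p ≠ ⊤ := ne_top_of_le_ne_top ENNReal.one_ne_top hp1
  have hq1 : q ≤ 1 := hqp ▸ le_self_add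
  have hqt : q ≠ ⊤ := ne_top_of_le_ne_top ENNReal.one_ne_top hq1
  rcases eq_or_ne p 0 with h0 | h0
  · subst h0
    have hq : q = 1 := by rwa [add_zero] at hqp
    rcases lt_or_gt_of_ne hα1 with h1 | h1
    · simp [tiltRight, ENNReal.zero_rpow_of_pos (show 0 < 1 - α by linarith)]
    · rw [hq, ENNReal.one_rpow, ENNReal.zero_rpow_of_neg (by linarith)] at hfin
      simp at hfin
  · have hev : ∀ᶠ n in atTop, hellingerReg α q p (S n) = tiltRight α q p (S n) := by
      filter_upwards [hS.eventually_lt_const (pos_iff_ne_zero.2 h0)] with n hn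
      rw [tiltRight_eq_of_le (hS0 n) hpt hn.le]
    refine Tendsto.congr' hev ?_
    refine ENNReal.Tendsto.mul (tendsto_max_rpow hS q α) (Or.inr ?_)
      (tendsto_max_rpow hS p (1 - α)) (Or.inr ?_)
    · exact ENNReal.rpow_ne_top_of_ne_zero h0 hpt
    · exact ENNReal.rpow_ne_top_of_nonneg hα.le hqt

/-- The truncated log-likelihood ratio `log ((q ∨ s) / (p ∨ s))`. -/
def truncatedLogRatio (q p s : ℝ≥0∞) : ℝ := Real.log (max q s).toReal - Real.log (max p s).toReal

lemma ofReal_exp_mul_truncatedLogRatio (hq : q ≤ 1) (hp : p ≤ 1) (hs : s ≠ 0) (hs1 : s ≤ 1)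
    (c : ℝ) : ENNReal.ofReal (Real.exp (c * truncatedLogRatio q p s)) =
      max q s ^ c * max p s ^ (-c) := by
  have key : ∀ t : ℝ≥0∞, t ≤ 1 → ∀ c : ℝ,
      ENNReal.ofReal (Real.exp (c * Real.log (max t s).toReal)) = max t s ^ c := by
    intro t ht c
    have hne : max t s ≠ ⊤ := ne_top_of_le_ne_top ENNReal.one_ne_top (max_le ht hs1)
    have hpos : 0 < (max t s).toReal :=
      ENNReal.toReal_pos (lt_of_lt_of_le (pos_iff_ne_zero.2 hs) (le_max_right _ _)).ne' hne
    rw [mul_comm, ← Real.rpow_def_of_pos hpos, ← ENNReal.ofReal_rpow_of_pos hpos,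
      ENNReal.ofReal_toReal hne]
  unfold truncatedLogRatio
  rw [mul_sub, sub_eq_add_neg, Real.exp_add, ENNReal.ofReal_mul (Real.exp_pos _).le, key q hq,
    ← neg_mul, key p hp]

lemma abs_truncatedLogRatio_le (hq : q ≤ 1) (hp : p ≤ 1) (hs : s ≠ 0) (hs1 : s ≤ 1) :
    |truncatedLogRatio q p s| ≤ -Real.log s.toReal := by
  have hst : s ≠ ⊤ := ne_top_of_le_ne_top ENNReal.one_ne_top hs1
  have hspos := ENNReal.toReal_pos hs hst
  have key : ∀ t : ℝ≥0∞, t ≤ 1 → Real.log s.toReal ≤ Real.log (max t s).toReal ∧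
      Real.log (max t s).toReal ≤ 0 := by
    intro t ht
    have hne : max t s ≠ ⊤ := ne_top_of_le_ne_top ENNReal.one_ne_top (max_le ht hs1)
    refine ⟨Real.log_le_log hspos (ENNReal.toReal_mono hne (le_max_right _ _)),
      Real.log_nonpos ENNReal.toReal_nonneg ?_⟩
    exact ENNReal.toReal_mono ENNReal.one_ne_top (max_le ht hs1)
  unfold truncatedLogRatio
  have h1 := key q hq
  have h2 := key p hp
  rw [abs_le]
  constructor <;> linarith [h1.1, h1.2, h2.1, h2.2]

/-- The two logarithmic terms of the objective combine to the normalization `1 / (α (α - 1))`.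
For `α > 1` the value `l = -∞` has to be excluded, since it would give `-∞ + ∞` on the left. -/
lemma inv_mul_sub_inv_mul {α : ℝ} (hα0 : 0 < α) (hα1 : α ≠ 1) {l : EReal}
    (htop : l ≠ ⊤) (hbot : 1 < α → l ≠ ⊥) :
    (((α - 1)⁻¹ : ℝ) : EReal) * l - ((α⁻¹ : ℝ) : EReal) * l =
      ((1 / (α * (α - 1)) : ℝ) : EReal) * l := by
  have h3 : α - 1 ≠ 0 := sub_ne_zero.2 hα1
  induction l with
  | bot =>
    rcases lt_or_gt_of_ne hα1 with h1 | h1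
    · have hc : 1 / (α * (α - 1)) < 0 := one_div_neg.2 (mul_neg_of_pos_of_neg hα0 (by linarith))
      rw [EReal.coe_mul_bot_of_neg hc, EReal.coe_mul_bot_of_neg (inv_neg''.2 (by linarith)),
        EReal.coe_mul_bot_of_pos (inv_pos.2 hα0)]
      simp
    · exact absurd rfl (hbot h1)
  | top => exact absurd rfl htop
  | coe x =>
    norm_cast
    field_simp
    ring

section Measure

variable {E : Type*} [MeasurableSpace E] {Q P : Measure E} [IsProbabilityMeasure Q]
  [IsProbabilityMeasure P]

lemma hellinger_ne_zero_of_one_lt {α : ℝ} (hα1 : 1 < α) : hellinger α Q P ≠ 0 := by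
  intro h0
  have h := lintegral_exp_le_of_one_lt hα1 (Q := Q) (P := P) (φ := fun _ => 0) measurable_const
    (by simp [h0])
  have : 0 < α⁻¹ := by positivity
  simp [h0, ENNReal.zero_rpow_of_pos this] at h

lemma hellinger_ne_top_of_lt_one {α : ℝ} (hα0 : 0 < α) (hα1 : α < 1) : hellinger α Q P ≠ ⊤ := by
  have h := hellinger_le_of_lt_one hα0 hα1 (Q := Q) (P := P) (φ := fun _ => 0) measurable_const
  refine ne_top_of_le_ne_top ENNReal.one_ne_top (h.trans ?_)
  simp

lemma tendsto_const_mul_log {c : ℝ} (hc : c ≠ 0) {U : ℕ → ℝ≥0∞} {J : ℝ≥0∞}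
    (hU : Tendsto U atTop (𝓝 J)) :
    Tendsto (fun n => (c : EReal) * ENNReal.log (U n)) atTop (𝓝 (c * ENNReal.log J)) := by
  refine EReal.Tendsto.mul tendsto_const_nhds
    ((ENNReal.continuous_log.tendsto J).comp hU) ?_ ?_ ?_ ?_
  · left; exact_mod_cast hc
  · left; exact_mod_cast hc
  · left; exact EReal.coe_ne_bot c
  · left; exact EReal.coe_ne_top c

/-- If both exponential moments converge to the Hellinger integral, the objective converges to the
divergence. -/
lemma tendsto_log_combination {α : ℝ} (hα0 : 0 < α) (hα1 : α ≠ 1) {U V : ℕ → ℝ≥0∞} {J : ℝ≥0∞}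
    (hU : Tendsto U atTop (𝓝 J)) (hV : Tendsto V atTop (𝓝 J)) (hJtop : J ≠ ⊤)
    (hJ0 : 1 < α → J ≠ 0) :
    Tendsto (fun n => (((α - 1)⁻¹ : ℝ) : EReal) * ENNReal.log (U n) -
      ((α⁻¹ : ℝ) : EReal) * ENNReal.log (V n)) atTop
      (𝓝 (((1 / (α * (α - 1)) : ℝ) : EReal) * ENNReal.log J)) := by
  rw [← inv_mul_sub_inv_mul hα0 hα1 (l := ENNReal.log J) (by simpa using hJtop)
    (fun h => by simpa using hJ0 h)]
  simp only [sub_eq_add_neg]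
  have h1 := tendsto_const_mul_log (inv_ne_zero (sub_ne_zero.2 hα1)) hU
  have h2 := (tendsto_const_mul_log (inv_ne_zero hα0.ne') hV).neg
  have hcond : ((α - 1)⁻¹ : ℝ) * ENNReal.log J ≠ ⊤ ∨ -((α⁻¹ : ℝ) * ENNReal.log J) ≠ ⊥ := by
    right
    rcases eq_or_ne J 0 with h0 | h0
    · rw [h0, ENNReal.log_zero, EReal.coe_mul_bot_of_pos (inv_pos.2 hα0)]; simp
    · rw [ENNReal.log_pos_real h0 hJtop, ← EReal.coe_mul, ← EReal.coe_neg]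
      exact EReal.coe_ne_bot _
  have hcond' : ((α - 1)⁻¹ : ℝ) * ENNReal.log J ≠ ⊥ ∨ -((α⁻¹ : ℝ) * ENNReal.log J) ≠ ⊤ := by
    left
    rcases eq_or_ne J 0 with h0 | h0
    · have h1 : α < 1 := by
        by_contra h
        exact hJ0 (lt_of_le_of_ne (not_lt.1 h) hα1.symm) h0
      rw [h0, ENNReal.log_zero, EReal.coe_mul_bot_of_neg (inv_neg''.2 (by linarith))]; simp
    · rw [ENNReal.log_pos_real h0 hJtop, ← EReal.coe_mul]
      exact EReal.coe_ne_bot _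
  exact (EReal.continuousAt_add hcond hcond').tendsto.comp (h1.prodMk_nhds h2)

/-- For `α > 1`, a diverging first moment `U` makes the objective diverge even when `V` diverges
too, provided `V ≤ U + C`: the weights satisfy `1 / (α - 1) > 1 / α`. -/
lemma exists_lt_log_combination {α : ℝ} (hα1 : 1 < α) {U V : ℕ → ℝ≥0∞} {C : ℝ≥0∞} (hC : C ≠ ⊤)
    (hU : Tendsto U atTop (𝓝 ⊤)) (hUtop : ∀ n, U n ≠ ⊤) (hV : ∀ n, V n ≤ U n + C) (L : ℝ) :
    ∃ n, (L : EReal) < (((α - 1)⁻¹ : ℝ) : EReal) * ENNReal.log (U n) -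
      ((α⁻¹ : ℝ) : EReal) * ENNReal.log (V n) := by
  have hα0 : 0 < α := by linarith
  have hβ : 0 < α - 1 := by linarith
  -- once `U ≥ C` and `U ≥ 1`, the objective is at least
  -- `(1 / (α (α - 1))) log U - (1 / α) log 2`
  set T : ℝ := max (Real.exp (α * (α - 1) * (|L| + α⁻¹ * Real.log 2 + 1))) 1 with hT
  have hev : ∀ᶠ n in atTop, max (ENNReal.ofReal T) C < U n :=
    hU.eventually_const_lt (max_lt ENNReal.ofReal_lt_top hC.lt_top)
  obtain ⟨n, hn⟩ := hev.exists
  refine ⟨n, ?_⟩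
  have hTU : ENNReal.ofReal T < U n := (le_max_left _ _).trans_lt hn
  have hCU : C ≤ U n := (le_max_right _ _).trans hn.le
  have hT1 : 1 ≤ T := le_max_right _ _
  have hu : T < (U n).toReal := (ENNReal.ofReal_lt_iff_lt_toReal (by linarith) (hUtop n)).1 hTU
  set u := (U n).toReal with hu_def
  have hu0 : 0 < u := by linarith
  have hVle : V n ≤ ENNReal.ofReal (2 * u) := by
    refine (hV n).trans ?_
    rw [two_mul, ENNReal.ofReal_add hu0.le hu0.le, hu_def, ENNReal.ofReal_toReal (hUtop n)]
    gcongr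
  have hlogV : ENNReal.log (V n) ≤ ((Real.log (2 * u) : ℝ) : EReal) := by
    rw [← ENNReal.log_ofReal_of_pos (by linarith)]
    exact ENNReal.log_le_log hVle
  have hlogU : ENNReal.log (U n) = ((Real.log u : ℝ) : EReal) := by
    rw [← ENNReal.log_ofReal_of_pos hu0, hu_def, ENNReal.ofReal_toReal (hUtop n)]
  have hlogu : α * (α - 1) * (|L| + α⁻¹ * Real.log 2 + 1) < Real.log u := by
    rw [Real.lt_log_iff_exp_lt hu0]
    exact (le_max_left _ _).trans_lt hu
  calc (L : EReal) < (((α - 1)⁻¹ * Real.log u - α⁻¹ * Real.log (2 * u) : ℝ) : EReal) := by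
        rw [EReal.coe_lt_coe_iff, Real.log_mul two_ne_zero hu0.ne']
        have h1 : (α - 1)⁻¹ * Real.log u - α⁻¹ * (Real.log 2 + Real.log u) =
            (α * (α - 1))⁻¹ * Real.log u - α⁻¹ * Real.log 2 := by
          field_simp; ring
        rw [h1]
        have h2 := mul_lt_mul_of_pos_left hlogu (inv_pos.2 (mul_pos hα0 hβ))
        rw [← mul_assoc, inv_mul_cancel₀ (mul_pos hα0 hβ).ne', one_mul] at h2
        linarith [le_abs_self L]
    _ = (((α - 1)⁻¹ : ℝ) : EReal) * (Real.log u : ℝ) -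
        ((α⁻¹ : ℝ) : EReal) * (Real.log (2 * u) : ℝ) := by
        norm_cast
    _ ≤ _ := by
        rw [hlogU]
        refine EReal.sub_le_sub le_rfl ?_
        exact mul_le_mul_of_nonneg_left hlogV (by exact_mod_cast (inv_pos.2 hα0).le)

/-- Bounded measurable functions attain the divergence up to any `L < R_α`: the truncated
log-likelihood ratios are nearly optimal. -/
lemma exists_bounded_lt_objective_of_pos {α : ℝ} (hα0 : 0 < α) (hα1 : α ≠ 1) {L : ℝ}
    (hL : (L : EReal) < renyiPos α Q P) :
    ∃ (g : E → ℝ) (C : ℝ), Measurable g ∧ (∀ x, |g x| ≤ C) ∧ (L : EReal) < objective α Q P g := by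
  obtain ⟨q, p, hqm, hpm, hqp, hq, hp⟩ := exists_densities Q P
  rw [renyiPos_eq_log_hellinger hα0 hα1] at hL
  set S : ℕ → ℝ≥0∞ := fun n => ((n : ℝ≥0∞) + 2)⁻¹ with hSdef
  have hS0 : ∀ n, S n ≠ 0 := fun n => ENNReal.inv_ne_zero.2 (by finiteness)
  have hS2 : ∀ n, S n ≤ 1 / 2 := fun n => by
    rw [one_div]; exact ENNReal.inv_le_inv.2 le_add_self
  have hS1 : ∀ n, S n ≤ 1 := fun n => (hS2 n).trans (by simp)
  have hSt : ∀ n, S n ≠ ⊤ := fun n => ne_top_of_le_ne_top ENNReal.one_ne_top (hS1 n)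
  have hS : Tendsto S atTop (𝓝 0) := by
    have := (ENNReal.tendsto_inv_nat_nhds_zero).comp (tendsto_add_atTop_nat 2)
    refine this.congr fun n => ?_
    simp [S]
  have hq1 : ∀ x, q x ≤ 1 := fun x => hqp x ▸ le_self_add
  have hp1 : ∀ x, p x ≤ 1 := fun x => hqp x ▸ le_add_self
  have hqt : ∀ x, q x ≠ ⊤ := fun x => ne_top_of_le_ne_top ENNReal.one_ne_top (hq1 x)
  have hpt : ∀ x, p x ≠ ⊤ := fun x => ne_top_of_le_ne_top ENNReal.one_ne_top (hp1 x)
  set g : ℕ → E → ℝ := fun n x => truncatedLogRatio (q x) (p x) (S n) with hg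
  have hgm : ∀ n, Measurable (g n) := fun n => by
    simp only [hg, truncatedLogRatio]
    fun_prop
  have hgb : ∀ n x, |g n x| ≤ -Real.log (S n).toReal := fun n x =>
    abs_truncatedLogRatio_le (hq1 x) (hp1 x) (hS0 n) (hS1 n)
  have hmL : ∀ n, Measurable fun x => tiltLeft α (q x) (p x) (S n) := fun n => by
    unfold tiltLeft; fun_prop
  have hmR : ∀ n, Measurable fun x => tiltRight α (q x) (p x) (S n) := fun n => by
    unfold tiltRight; fun_prop
  have hU : ∀ n, ∫⁻ x, ENNReal.ofReal (Real.exp ((α - 1) * g n x)) ∂Q =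
      ∫⁻ x, tiltLeft α (q x) (p x) (S n) ∂(Q + P) := fun n => by
    rw [lintegral_eq_lintegral_density (absolutelyContinuous_add_left Q P) hq
      (by have := hgm n; fun_prop)]
    refine lintegral_congr fun x => ?_
    rw [ofReal_exp_mul_truncatedLogRatio (hq1 x) (hp1 x) (hS0 n) (hS1 n), tiltLeft, neg_sub]
  have hV : ∀ n, ∫⁻ x, ENNReal.ofReal (Real.exp (α * g n x)) ∂P =
      ∫⁻ x, tiltRight α (q x) (p x) (S n) ∂(Q + P) := fun n => by
    rw [lintegral_eq_lintegral_density (absolutelyContinuous_add_right Q P) hp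
      (by have := hgm n; fun_prop)]
    refine lintegral_congr fun x => ?_
    rw [ofReal_exp_mul_truncatedLogRatio (hq1 x) (hp1 x) (hS0 n) (hS1 n), tiltRight]
  suffices h : ∃ n, (L : EReal) < (((α - 1)⁻¹ : ℝ) : EReal) *
      ENNReal.log (∫⁻ x, tiltLeft α (q x) (p x) (S n) ∂(Q + P)) -
      ((α⁻¹ : ℝ) : EReal) * ENNReal.log (∫⁻ x, tiltRight α (q x) (p x) (S n) ∂(Q + P)) by
    obtain ⟨n, hn⟩ := h
    refine ⟨g n, _, hgm n, hgb n, ?_⟩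
    unfold objective
    rw [hU, hV]
    exact hn
  rw [hellinger_eq hq hp] at hL
  by_cases hJ : ∫⁻ x, q x ^ α * p x ^ (1 - α) ∂(Q + P) = ⊤
  · have h1 : 1 < α := by
      by_contra h
      refine hellinger_ne_top_of_lt_one (Q := Q) (P := P) hα0 (lt_of_le_of_ne (not_lt.1 h) hα1) ?_
      rw [hellinger_eq hq hp, hJ]
    refine exists_lt_log_combination h1 (C := 2) (by simp) ?_ (fun n => ?_) (fun n => ?_) L
    · -- Fatou's lemma
      refine tendsto_of_le_liminf_of_limsup_le ?_ le_top
      rw [← hJ]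
      refine le_trans (lintegral_mono fun x => ?_) (lintegral_liminf_le fun n => hmL n)
      exact (tendsto_tiltLeft hS hS0 hα0 (hqp x)).liminf_eq.ge
    · rw [← hU]
      have hb : ∀ x, ENNReal.ofReal (Real.exp ((α - 1) * g n x)) ≤
          ENNReal.ofReal (Real.exp ((α - 1) * -Real.log (S n).toReal)) := fun x => by
        exact ENNReal.ofReal_le_ofReal (Real.exp_le_exp.2
          (mul_le_mul_of_nonneg_left ((le_abs_self _).trans (hgb n x)) (by linarith)))
      refine ne_top_of_le_ne_top ?_ (lintegral_mono hb)
      simp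
    · calc ∫⁻ x, tiltRight α (q x) (p x) (S n) ∂(Q + P)
          ≤ ∫⁻ x, (tiltLeft α (q x) (p x) (S n) + 1) ∂(Q + P) := lintegral_mono fun x =>
            (tiltRight_le (hS0 n) (hSt n) (hpt x)).trans
              (hellingerReg_le_tiltLeft_add_one hα0 (hqp x) (hS0 n) (hS2 n))
        _ = _ := by
          rw [lintegral_add_right _ measurable_const]
          simp [one_add_one_eq_two]
  · have hint : ∫⁻ x, (q x ^ α * p x ^ (1 - α) + 1) ∂(Q + P) ≠ ⊤ := by
      rw [lintegral_add_right _ measurable_const]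
      exact ENNReal.add_ne_top.2 ⟨hJ, by simp⟩
    have h1 : Tendsto (fun n => ∫⁻ x, tiltLeft α (q x) (p x) (S n) ∂(Q + P)) atTop
        (𝓝 (∫⁻ x, q x ^ α * p x ^ (1 - α) ∂(Q + P))) := by
      refine tendsto_lintegral_of_dominated_convergence _ hmL
        (fun n => ae_of_all _ fun x => ?_) hint (ae_of_all _ fun x => ?_)
      · exact (tiltLeft_le (hS0 n) (hSt n) (hqt x)).trans
          (hellingerReg_le hα0 (hqp x) (hS0 n) (hS2 n))
      · exact tendsto_tiltLeft hS hS0 hα0 (hqp x)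
    have h2 : Tendsto (fun n => ∫⁻ x, tiltRight α (q x) (p x) (S n) ∂(Q + P)) atTop
        (𝓝 (∫⁻ x, q x ^ α * p x ^ (1 - α) ∂(Q + P))) := by
      refine tendsto_lintegral_of_dominated_convergence _ hmR
        (fun n => ae_of_all _ fun x => ?_) hint ?_
      · exact (tiltRight_le (hS0 n) (hSt n) (hpt x)).trans
          (hellingerReg_le hα0 (hqp x) (hS0 n) (hS2 n))
      · filter_upwards [ae_lt_top (by fun_prop) hJ] with x hx
        exact tendsto_tiltRight hS hS0 hα0 hα1 (hqp x) hx.ne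
    have h3 := tendsto_log_combination hα0 hα1 h1 h2 hJ
      (fun h => by rw [← hellinger_eq hq hp]; exact hellinger_ne_zero_of_one_lt h)
    exact (h3.eventually_const_lt hL).exists

end Measure

end LowerBound

/-! ### The variational formula for all orders -/

section Variational

variable {E : Type*} [MeasurableSpace E] {Q P : Measure E} [IsProbabilityMeasure Q]
  [IsProbabilityMeasure P] {α : ℝ}

lemma objective_le_renyiDiv (hα0 : α ≠ 0) (hα1 : α ≠ 1) {φ : E → ℝ} (hφ : Measurable φ)
    (hQ : Integrable (fun x => Real.exp ((α - 1) * φ x)) Q)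
    (hP : Integrable (fun x => Real.exp (α * φ x)) P) :
    objective α Q P φ ≤ renyiDiv α Q P := by
  unfold renyiDiv
  split_ifs with h
  · exact objective_le_renyiPos h hα1 hφ hQ hP
  · rw [← objective_swap hQ hP]
    have h' : α < 0 := lt_of_le_of_ne (not_lt.1 h) hα0
    refine objective_le_renyiPos (by linarith) (by simpa using hα0) hφ.neg ?_ ?_
    · convert hP using 3; simp
    · convert hQ using 3; ring

lemma integrable_exp_mul_of_bounded (Q : Measure E) [IsFiniteMeasure Q] {g : E → ℝ} {C : ℝ}
    (hg : Measurable g) (hC : ∀ x, |g x| ≤ C) (c : ℝ) :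
    Integrable (fun x => Real.exp (c * g x)) Q := by
  refine Integrable.of_bound (C := Real.exp (|c| * C)) (by fun_prop) (ae_of_all _ fun x => ?_)
  rw [Real.norm_eq_abs, Real.abs_exp, Real.exp_le_exp]
  exact (le_abs_self _).trans ((abs_mul _ _).trans_le (by gcongr; exact hC x))

lemma exists_bounded_lt_objective (hα0 : α ≠ 0) (hα1 : α ≠ 1) {L : ℝ}
    (hL : (L : EReal) < renyiDiv α Q P) :
    ∃ (g : E → ℝ) (C : ℝ), Measurable g ∧ (∀ x, |g x| ≤ C) ∧ (L : EReal) < objective α Q P g := by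
  unfold renyiDiv at hL
  split_ifs at hL with h
  · exact exists_bounded_lt_objective_of_pos h hα1 hL
  · have h' : α < 0 := lt_of_le_of_ne (not_lt.1 h) hα0
    obtain ⟨g, C, hg, hC, hlt⟩ := exists_bounded_lt_objective_of_pos (α := 1 - α) (by linarith)
      (by simpa using hα0) hL
    refine ⟨fun x => -g x, C, hg.neg, fun x => by rw [abs_neg]; exact hC x, ?_⟩
    rw [← objective_swap (integrable_exp_mul_of_bounded P hg hC _)
      (integrable_exp_mul_of_bounded Q hg hC _)] at hlt
    simpa using hlt

lemma renyiDiv_nonneg (hα0 : α ≠ 0) (hα1 : α ≠ 1) : 0 ≤ renyiDiv α Q P := by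
  have h := objective_le_renyiDiv (Q := Q) (P := P) hα0 hα1 (φ := fun _ => 0) measurable_const
    (by simp) (by simp)
  simpa [objective] using h

end Variational

/-! ### The objective for empirical measures -/

section Empirical

variable {E : Type*} [MeasurableSpace E]

lemma lintegral_exp_empiricalMeasure {φ : E → ℝ} (hφ : Measurable φ) (x : ℕ → E) {n : ℕ}
    (hn : 0 < n) :
    ∫⁻ y, ENNReal.ofReal (Real.exp (φ y)) ∂(empiricalMeasure x n) =
      ENNReal.ofReal ((n : ℝ)⁻¹ * ∑ i ∈ Finset.range n, Real.exp (φ (x i))) := by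
  unfold empiricalMeasure
  rw [lintegral_smul_measure, lintegral_finsetSum_measure,
    ENNReal.ofReal_mul (by positivity),
    ENNReal.ofReal_sum_of_nonneg (fun i _ => (Real.exp_pos _).le),
    ENNReal.ofReal_inv_of_pos (by exact_mod_cast hn), ENNReal.ofReal_natCast, smul_eq_mul]
  congr 1
  refine Finset.sum_congr rfl fun i _ => ?_
  rw [lintegral_dirac' _ (by fun_prop)]

lemma objective_empiricalMeasure {α : ℝ} {φ : E → ℝ} (hφ : Measurable φ) (x y : ℕ → E) {n : ℕ}
    (hn : 0 < n) :
    objective α (empiricalMeasure x n) (empiricalMeasure y n) φ =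
      (objectiveValue α ((n : ℝ)⁻¹ * ∑ i ∈ Finset.range n, Real.exp ((α - 1) * φ (x i)))
        ((n : ℝ)⁻¹ * ∑ i ∈ Finset.range n, Real.exp (α * φ (y i))) : EReal) := by
  have hne : (Finset.range n).Nonempty := Finset.nonempty_range_iff.2 hn.ne'
  have hn' : (0 : ℝ) < (n : ℝ)⁻¹ := by positivity
  exact objective_eq_coe (mul_pos hn' (Finset.sum_pos (fun i _ => Real.exp_pos _) hne))
    (mul_pos hn' (Finset.sum_pos (fun i _ => Real.exp_pos _) hne))
    (lintegral_exp_empiricalMeasure (hφ.const_mul _) x hn)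
    (lintegral_exp_empiricalMeasure (hφ.const_mul _) y hn)

end Empirical

/-! ### Uniform laws of large numbers -/

section NullSequences

variable {N : Type*} [MeasurableSpace N] {μ : Measure N}

lemma tendsto_measure_zero_of_subset {A B : ℕ → Set N} (h : ∀ᶠ n in atTop, A n ⊆ B n)
    (hB : Tendsto (fun n => μ (B n)) atTop (𝓝 0)) : Tendsto (fun n => μ (A n)) atTop (𝓝 0) :=
  tendsto_of_tendsto_of_tendsto_of_le_of_le' tendsto_const_nhds hB
    (Eventually.of_forall fun _ => zero_le) (h.mono fun _ hn => measure_mono hn)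

lemma tendsto_measure_union_zero {A B : ℕ → Set N}
    (hA : Tendsto (fun n => μ (A n)) atTop (𝓝 0)) (hB : Tendsto (fun n => μ (B n)) atTop (𝓝 0)) :
    Tendsto (fun n => μ (A n ∪ B n)) atTop (𝓝 0) := by
  have h := hA.add hB
  rw [add_zero] at h
  exact tendsto_of_tendsto_of_tendsto_of_le_of_le tendsto_const_nhds h
    (fun _ => zero_le) (fun _ => measure_union_le _ _)

end NullSequences

section LawOfLargeNumbers

variable {E : Type*} [TopologicalSpace E] [MeasurableSpace E] [OpensMeasurableSpace E]
  {N : Type*} [MeasurableSpace N] {μ : Measure N} [IsProbabilityMeasure μ]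
  {T : Type*} [TopologicalSpace T] [CompactSpace T] [T2Space T] [SecondCountableTopology T]

/-- The uniform weak law of large numbers over a compact parameter space `T`. It is the strong law
in the separable Banach space `C(T, ℝ)`, applied to the random functions `t ↦ f (X i, t)`. -/
lemma tendsto_measure_exists_lt_abs_average_sub {Q : Measure E} {X : ℕ → N → E}
    (hX : IsIIDSample X Q μ) (f : C(E × T, ℝ)) {G : E → ℝ} (hG : Integrable G Q)
    (hfG : ∀ x t, |f (x, t)| ≤ G x) {ε : ℝ} (hε : 0 < ε) :
    Tendsto (fun n : ℕ => μ {ω | ∃ t, ε ≤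
      |(n : ℝ)⁻¹ * ∑ i ∈ Finset.range n, f (X i ω, t) - ∫ x, f (x, t) ∂Q|}) atTop (𝓝 0) := by
  borelize C(T, ℝ)
  let Z : ℕ → N → C(T, ℝ) := fun i ω => f.curry (X i ω)
  have hZc : Measurable (fun x => f.curry x) := f.curry.continuous.measurable
  have hZm : ∀ i, Measurable (Z i) := fun i => hZc.comp (hX.measurable i)
  have hnorm : ∀ x, ‖f.curry x‖ ≤ |G x| := fun x => by
    refine (ContinuousMap.norm_le _ (abs_nonneg _)).2 fun t => ?_
    exact (hfG x t).trans (le_abs_self _)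
  have hZint : Integrable (Z 0) μ := by
    have h0 : Integrable (fun ω => G (X 0 ω)) μ := by
      have := hX.law 0 ▸ hG
      exact this.comp_measurable (hX.measurable 0)
    refine h0.abs.mono' (hZm 0).aestronglyMeasurable (ae_of_all _ fun ω => hnorm _)
  have hident : ∀ i, IdentDistrib (Z i) (Z 0) μ μ := fun i =>
    IdentDistrib.comp (u := fun x => f.curry x)
      ⟨(hX.measurable i).aemeasurable, (hX.measurable 0).aemeasurable,
        (hX.law i).trans (hX.law 0).symm⟩ hZc
  have hindep : Pairwise (Function.onFun (fun f g => IndepFun f g μ) Z) := fun i j hij =>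
    (hX.indep.indepFun hij).comp hZc hZc
  have hlln := tendstoInMeasure_of_tendsto_ae
    (f := fun n ω => (n : ℝ)⁻¹ • ∑ i ∈ Finset.range n, Z i ω) (g := fun _ => ∫ ω, Z 0 ω ∂μ)
    (fun n => (Measurable.aestronglyMeasurable (by fun_prop)))
    (strong_law_ae Z hZint hindep hident) (ENNReal.ofReal ε) (by simpa using hε)
  refine tendsto_measure_zero_of_subset (Eventually.of_forall fun n ω => ?_) hlln
  rintro ⟨t, ht⟩
  have hint : ∫ x, f (x, t) ∂Q = (∫ ω, Z 0 ω ∂μ) t := by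
    have h1 := (ContinuousMap.evalCLM ℝ (M := ℝ) t).integral_comp_comm hZint
    have h2 : ∫ x, f (x, t) ∂Q = ∫ ω, f (X 0 ω, t) ∂μ := by
      rw [← hX.law 0, integral_map (hX.measurable 0).aemeasurable]
      exact (f.continuous.comp (by fun_prop : Continuous fun x => (x, t))).measurable
        |>.aestronglyMeasurable
    rw [h2]
    exact h1
  have hle : |(n : ℝ)⁻¹ * ∑ i ∈ Finset.range n, f (X i ω, t) - ∫ x, f (x, t) ∂Q| ≤
      ‖(n : ℝ)⁻¹ • ∑ i ∈ Finset.range n, Z i ω - ∫ ω, Z 0 ω ∂μ‖ := by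
    rw [hint]
    have h3 := ContinuousMap.norm_coe_le_norm
      ((n : ℝ)⁻¹ • ∑ i ∈ Finset.range n, Z i ω - ∫ ω, Z 0 ω ∂μ) t
    simpa [Z] using h3
  change ENNReal.ofReal ε ≤ edist _ _
  rw [edist_dist, dist_eq_norm]
  exact ENNReal.ofReal_le_ofReal (ht.trans hle)

lemma exists_pos_forall_le_integral_exp {Q : Measure E} [IsProbabilityMeasure Q]
    (ψ : C(E × T, ℝ)) {G : E → ℝ} (hG : Integrable G Q)
    (hψ : ∀ x t, Real.exp (ψ (x, t)) ≤ G x) :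
    ∃ c : ℝ, 0 < c ∧ ∀ t, c ≤ ∫ x, Real.exp (ψ (x, t)) ∂Q := by
  have hcont : Continuous fun t => ∫ x, Real.exp (ψ (x, t)) ∂Q := by
    refine continuous_of_dominated (fun t => ?_) (fun t => ae_of_all _ fun x => ?_) hG
      (ae_of_all _ fun x => by fun_prop)
    · exact (by fun_prop : Continuous fun x => Real.exp (ψ (x, t))).measurable.aestronglyMeasurable
    · rw [Real.norm_eq_abs, Real.abs_exp]; exact hψ x t
  have hpos : ∀ t, 0 < ∫ x, Real.exp (ψ (x, t)) ∂Q := fun t => by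
    refine integral_exp_pos (hG.mono' ?_ (ae_of_all _ fun x => ?_))
    · exact (by fun_prop : Continuous fun x => Real.exp (ψ (x, t))).measurable.aestronglyMeasurable
    · rw [Real.norm_eq_abs, Real.abs_exp]; exact hψ x t
  rcases isEmpty_or_nonempty T with h | h
  · exact ⟨1, one_pos, fun t => isEmptyElim t⟩
  · obtain ⟨t, -, ht⟩ := isCompact_univ.exists_isMinOn Set.univ_nonempty hcont.continuousOn
    exact ⟨_, hpos t, fun s => ht (Set.mem_univ s)⟩

lemma abs_log_sub_log_le {c u v : ℝ} (hc : 0 < c) (hu : c ≤ u) (hv : c ≤ v) :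
    |Real.log u - Real.log v| ≤ |u - v| / c := by
  have key : ∀ {a b : ℝ}, c ≤ a → c ≤ b → Real.log a - Real.log b ≤ |a - b| / c := by
    intro a b ha hb
    have ha0 : 0 < a := hc.trans_le ha
    have hb0 : 0 < b := hc.trans_le hb
    rw [← Real.log_div ha0.ne' hb0.ne']
    refine (Real.log_le_sub_one_of_pos (div_pos ha0 hb0)).trans ?_
    rw [div_sub_one hb0.ne']
    calc (a - b) / b ≤ |a - b| / b := by gcongr; exact le_abs_self _
      _ ≤ |a - b| / c := by gcongr
  rw [abs_le]
  refine ⟨?_, key hu hv⟩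
  have := key hv hu
  rw [abs_sub_comm] at this
  linarith

/-- Uniform law of large numbers for logarithms of exponential moments. -/
lemma tendsto_measure_not_forall_log_average_exp {Q : Measure E} [IsProbabilityMeasure Q]
    {X : ℕ → N → E} (hX : IsIIDSample X Q μ) (ψ : C(E × T, ℝ)) {G : E → ℝ} (hG : Integrable G Q)
    (hψ : ∀ x t, Real.exp (ψ (x, t)) ≤ G x) {δ : ℝ} (hδ : 0 < δ) :
    Tendsto (fun n : ℕ => μ {ω | ¬ ∀ t,
      |Real.log ((n : ℝ)⁻¹ * ∑ i ∈ Finset.range n, Real.exp (ψ (X i ω, t))) -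
        Real.log (∫ x, Real.exp (ψ (x, t)) ∂Q)| ≤ δ}) atTop (𝓝 0) := by
  obtain ⟨c, hc, hcle⟩ := exists_pos_forall_le_integral_exp ψ hG hψ
  have hlln := tendsto_measure_exists_lt_abs_average_sub hX
    (f := ⟨fun z => Real.exp (ψ z), by fun_prop⟩) hG
    (fun x t => by simpa using hψ x t) (ε := min (c / 2) (δ * (c / 2)))
    (lt_min (by positivity) (by positivity))
  refine tendsto_measure_zero_of_subset (Eventually.of_forall fun n ω hω => ?_) hlln
  by_contra hcon
  refine hω fun t => ?_
  have ht : ¬ _ ≤ _ := fun h => hcon ⟨t, h⟩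
  rw [not_le, lt_min_iff] at ht
  obtain ⟨h1, h2⟩ := ht
  simp only [ContinuousMap.coe_mk] at h1 h2
  have hc2 : c / 2 ≤ (n : ℝ)⁻¹ * ∑ i ∈ Finset.range n, Real.exp (ψ (X i ω, t)) := by
    linarith [(abs_lt.1 h1).1, hcle t]
  refine (abs_log_sub_log_le (half_pos hc) hc2 (by linarith [hcle t])).trans ?_
  rw [div_le_iff₀ (half_pos hc)]
  exact h2.le

/-- Uniform law of large numbers for the objective over a compact family of functions whose
exponentials have integrable envelopes. -/
lemma tendsto_measure_not_forall_objective_close {Q P : Measure E} [IsProbabilityMeasure Q]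
    [IsProbabilityMeasure P] {X Y : ℕ → N → E} (hX : IsIIDSample X Q μ) (hY : IsIIDSample Y P μ)
    (α : ℝ) (φ : C(E × T, ℝ)) {G H : E → ℝ} (hG : Integrable G Q) (hH : Integrable H P)
    (hφG : ∀ x t, Real.exp ((α - 1) * φ (x, t)) ≤ G x)
    (hφH : ∀ x t, Real.exp (α * φ (x, t)) ≤ H x) {δ : ℝ} (hδ : 0 < δ) :
    Tendsto (fun n : ℕ => μ {ω | ¬ ∀ t,
      objective α (empiricalMeasure (fun i => X i ω) n) (empiricalMeasure (fun i => Y i ω) n)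
        (fun x => φ (x, t)) ≤ objective α Q P (fun x => φ (x, t)) + (δ : EReal) ∧
      objective α Q P (fun x => φ (x, t)) ≤
        objective α (empiricalMeasure (fun i => X i ω) n) (empiricalMeasure (fun i => Y i ω) n)
          (fun x => φ (x, t)) + (δ : EReal)}) atTop (𝓝 0) := by
  set M : ℝ := |(α - 1)⁻¹| + |α⁻¹| + 1 with hM
  have hM0 : 0 < M := by positivity
  have h1 := tendsto_measure_not_forall_log_average_exp hX
    (ψ := ⟨fun z => (α - 1) * φ z, by fun_prop⟩) hG hφG (δ := δ / M) (by positivity)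
  have h2 := tendsto_measure_not_forall_log_average_exp hY
    (ψ := ⟨fun z => α * φ z, by fun_prop⟩) hH hφH (δ := δ / M) (by positivity)
  refine tendsto_measure_zero_of_subset ?_ (tendsto_measure_union_zero h1 h2)
  filter_upwards [eventually_gt_atTop 0] with n hn ω hω
  by_contra hcon
  simp only [Set.mem_union, Set.mem_ofPred_eq, not_or, not_not, ContinuousMap.coe_mk] at hcon
  refine hω fun t => ?_
  have hφm : Continuous fun x => φ (x, t) := by fun_prop
  have e1 := hcon.1 t
  have e2 := hcon.2 t
  rw [objective_empiricalMeasure hφm.measurable _ _ hn, objective_eq_coe_integral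
    (hG.mono' (by fun_prop : Continuous fun x =>
      Real.exp ((α - 1) * φ (x, t))).measurable.aestronglyMeasurable
      (ae_of_all _ fun x => by
        rw [Real.norm_eq_abs, Real.abs_exp]; exact hφG x t))
    (hH.mono' (by fun_prop : Continuous fun x =>
      Real.exp (α * φ (x, t))).measurable.aestronglyMeasurable
      (ae_of_all _ fun x => by
        rw [Real.norm_eq_abs, Real.abs_exp]; exact hφH x t))]
  unfold objectiveValue
  norm_cast
  generalize Real.log ((n : ℝ)⁻¹ * ∑ i ∈ Finset.range n, Real.exp ((α - 1) * φ (X i ω, t))) = a at *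
  generalize Real.log (∫ x, Real.exp ((α - 1) * φ (x, t)) ∂Q) = a' at *
  generalize Real.log ((n : ℝ)⁻¹ * ∑ i ∈ Finset.range n, Real.exp (α * φ (Y i ω, t))) = b at *
  generalize Real.log (∫ x, Real.exp (α * φ (x, t)) ∂P) = b' at *
  have hbound : |((α - 1)⁻¹ * a - α⁻¹ * b) - ((α - 1)⁻¹ * a' - α⁻¹ * b')| ≤ δ := by
    calc |((α - 1)⁻¹ * a - α⁻¹ * b) - ((α - 1)⁻¹ * a' - α⁻¹ * b')|
        = |(α - 1)⁻¹ * (a - a') - α⁻¹ * (b - b')| := by congr 1; ring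
      _ ≤ |(α - 1)⁻¹ * (a - a')| + |α⁻¹ * (b - b')| := abs_sub _ _
      _ ≤ |(α - 1)⁻¹| * (δ / M) + |α⁻¹| * (δ / M) := by
        rw [abs_mul, abs_mul]; gcongr
      _ ≤ M * (δ / M) := by
        rw [← add_mul]
        gcongr
        linarith
      _ = δ := mul_div_cancel₀ _ hM0.ne'
  constructor <;> linarith [(abs_le.1 hbound).1, (abs_le.1 hbound).2]

end LawOfLargeNumbers

/-! ### Consistency from compactness and density -/

section Consistency

section Stability

variable {E : Type*} [MeasurableSpace E]

lemma abs_exp_mul_sub_exp_mul_le {c C s t : ℝ} (hs : |s| ≤ C) (ht : |t| ≤ C) :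
    |Real.exp (c * s) - Real.exp (c * t)| ≤ |c| * Real.exp (|c| * C) * |s - t| := by
  have h := Convex.norm_image_sub_le_of_norm_deriv_le (𝕜 := ℝ) (f := fun x => Real.exp (c * x))
    (s := Set.Icc (-C) C) (x := t) (y := s) (C := |c| * Real.exp (|c| * C))
    (fun x _ => by fun_prop) (fun x hx => ?_) (convex_Icc _ _) (abs_le.1 ht) (abs_le.1 hs)
  · simpa [Real.norm_eq_abs] using h
  · have hd : deriv (fun x => Real.exp (c * x)) x = Real.exp (c * x) * c := by
      have := ((hasDerivAt_id x).const_mul c).exp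
      simpa using this.deriv
    rw [hd, Real.norm_eq_abs, abs_mul, Real.abs_exp, mul_comm]
    exact mul_le_mul_of_nonneg_left (Real.exp_le_exp.2 ((le_abs_self _).trans
      ((abs_mul _ _).trans_le (mul_le_mul_of_nonneg_left (abs_le.2 hx) (abs_nonneg _)))))
      (abs_nonneg _)

lemma abs_integral_exp_sub_le {Q ν : Measure E} [IsFiniteMeasure Q] [IsFiniteMeasure ν]
    (hQν : Q ≤ ν) {g φ : E → ℝ} {C : ℝ} (hg : Measurable g) (hφ : Measurable φ)
    (hgC : ∀ x, |g x| ≤ C) (hφC : ∀ x, |φ x| ≤ C) (c : ℝ) :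
    |∫ x, Real.exp (c * φ x) ∂Q - ∫ x, Real.exp (c * g x) ∂Q| ≤
      |c| * Real.exp (|c| * C) * ∫ x, |g x - φ x| ∂ν := by
  have hint : Integrable (fun x => |g x - φ x|) ν :=
    ((Integrable.of_bound hg.aestronglyMeasurable C (ae_of_all _ hgC)).sub
      (Integrable.of_bound hφ.aestronglyMeasurable C (ae_of_all _ hφC))).abs
  rw [← integral_sub (integrable_exp_mul_of_bounded Q hφ hφC c)
    (integrable_exp_mul_of_bounded Q hg hgC c)]
  refine (abs_integral_le_integral_abs).trans ?_
  calc ∫ x, |Real.exp (c * φ x) - Real.exp (c * g x)| ∂Q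
      ≤ ∫ x, |c| * Real.exp (|c| * C) * |g x - φ x| ∂Q := by
        refine integral_mono_of_nonneg (ae_of_all _ fun _ => abs_nonneg _)
          ((hint.mono_measure hQν).const_mul _) (ae_of_all _ fun x => ?_)
        have := abs_exp_mul_sub_exp_mul_le (c := c) (hφC x) (hgC x)
        rwa [abs_sub_comm (φ x)] at this
    _ = |c| * Real.exp (|c| * C) * ∫ x, |g x - φ x| ∂Q := integral_const_mul _ _
    _ ≤ _ := by
        gcongr
        exact ae_of_all _ fun _ => abs_nonneg _

/-- On uniformly bounded functions the objective is continuous for the `L¹(Q + P)` distance. -/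
lemma exists_forall_lt_objective {α : ℝ} {Q P : Measure E} [IsProbabilityMeasure Q]
    [IsProbabilityMeasure P] {g : E → ℝ} {C L : ℝ} (hg : Measurable g) (hgC : ∀ x, |g x| ≤ C)
    (hL : (L : EReal) < objective α Q P g) :
    ∃ η : ℝ, 0 < η ∧ ∀ φ : E → ℝ, Measurable φ → (∀ x, |φ x| ≤ C) →
      ∫ x, |g x - φ x| ∂(Q + P) < η → (L : EReal) < objective α Q P φ := by
  rw [objective_eq_coe_integral (integrable_exp_mul_of_bounded Q hg hgC _)
    (integrable_exp_mul_of_bounded P hg hgC _), EReal.coe_lt_coe_iff] at hL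
  have hu : 0 < ∫ x, Real.exp ((α - 1) * g x) ∂Q :=
    integral_exp_pos (integrable_exp_mul_of_bounded Q hg hgC _)
  have hv : 0 < ∫ x, Real.exp (α * g x) ∂P :=
    integral_exp_pos (integrable_exp_mul_of_bounded P hg hgC _)
  have hcont : ContinuousAt (fun z : ℝ × ℝ => objectiveValue α z.1 z.2)
      (∫ x, Real.exp ((α - 1) * g x) ∂Q, ∫ x, Real.exp (α * g x) ∂P) := by
    unfold objectiveValue
    exact (continuousAt_const.mul (continuousAt_fst.log hu.ne')).sub
      (continuousAt_const.mul (continuousAt_snd.log hv.ne'))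
  obtain ⟨r, hr, hball⟩ := Metric.eventually_nhds_iff.1 (hcont.eventually_const_lt hL)
  set K : ℝ := max (|α - 1| * Real.exp (|α - 1| * C)) (|α| * Real.exp (|α| * C)) + 1 with hK
  have hK0 : 0 < K := by positivity
  refine ⟨r / K, by positivity, fun φ hφ hφC hclose => ?_⟩
  rw [objective_eq_coe_integral (integrable_exp_mul_of_bounded Q hφ hφC _)
    (integrable_exp_mul_of_bounded P hφ hφC _), EReal.coe_lt_coe_iff]
  have h0 : 0 ≤ ∫ x, |g x - φ x| ∂(Q + P) := integral_nonneg fun _ => abs_nonneg _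
  have hKr : K * ∫ x, |g x - φ x| ∂(Q + P) < r := by
    rw [lt_div_iff₀ hK0] at hclose
    linarith
  refine hball (y := (_, _)) ?_
  rw [Prod.dist_eq, max_lt_iff, Real.dist_eq, Real.dist_eq]
  constructor
  · refine lt_of_le_of_lt (abs_integral_exp_sub_le (ν := Q + P) (Measure.le_add_right le_rfl)
      hg hφ hgC hφC _)
      (lt_of_le_of_lt ?_ hKr)
    gcongr
    exact (le_max_left _ _).trans (by linarith)
  · refine lt_of_le_of_lt (abs_integral_exp_sub_le (ν := Q + P) (Measure.le_add_left le_rfl)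
      hg hφ hgC hφC _)
      (lt_of_le_of_lt ?_ hKr)
    gcongr
    exact (le_max_right _ _).trans (by linarith)

end Stability

section UpperBoundInProbability

variable {E : Type*} [MeasurableSpace E] {N : Type*} [MeasurableSpace N]

/-- With probability tending to one, no function of `S` has an empirical objective exceeding the
divergence by more than `δ`. -/
def UpperBoundInProbability (α : ℝ) (Q P : Measure E)
    (X Y : ℕ → N → E) (μ : Measure N) (S : Set (E → ℝ)) : Prop :=
  ∀ δ : ℝ, 0 < δ → Tendsto (fun n : ℕ => μ {ω | ¬ ∀ φ ∈ S,
    objective α (empiricalMeasure (fun i => X i ω) n) (empiricalMeasure (fun i => Y i ω) n) φ ≤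
      renyiDiv α Q P + (δ : EReal)}) atTop (𝓝 0)

variable {α : ℝ} {Q P : Measure E} {X Y : ℕ → N → E} {μ : Measure N}

lemma UpperBoundInProbability.mono {S S' : Set (E → ℝ)}
    (h : UpperBoundInProbability α Q P X Y μ S') (hS : S ⊆ S') :
    UpperBoundInProbability α Q P X Y μ S := fun δ hδ =>
by
  refine tendsto_measure_zero_of_subset (Eventually.of_forall fun n ω hω => ?_) (h δ hδ)
  exact fun hcon => hω fun φ hφ => hcon φ (hS hφ)

lemma UpperBoundInProbability.biUnion {ι : Type*} {s : Set ι} (hs : s.Finite)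
    {S : ι → Set (E → ℝ)} (h : ∀ i ∈ s, UpperBoundInProbability α Q P X Y μ (S i)) :
    UpperBoundInProbability α Q P X Y μ (⋃ i ∈ s, S i) := by
  induction s, hs using Set.Finite.induction_on with
  | empty =>
    intro δ hδ
    simp
  | @insert i s hi hs ih =>
    intro δ hδ
    refine tendsto_measure_zero_of_subset (Eventually.of_forall fun n ω hω => ?_)
      (tendsto_measure_union_zero (h i (Set.mem_insert _ _) δ hδ)
        (ih (fun j hj => h j (Set.mem_insert_of_mem _ hj)) δ hδ))
    by_contra hcon
    simp only [Set.mem_union, Set.mem_ofPred_eq, not_or, not_not] at hcon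
    refine hω fun φ hφ => ?_
    rw [Set.biUnion_insert] at hφ
    exact hφ.elim (hcon.1 φ) (hcon.2 φ)

end UpperBoundInProbability

variable {E : Type*} [TopologicalSpace E] [MeasurableSpace E]

/-- Every bounded continuous function is an `L¹(Q + P)`-limit of uniformly bounded functions each
of which eventually belongs to the spaces `Φ k`. -/
def BoundedlyDense (Q P : Measure E) (Φ : ℕ → Set (E → ℝ)) : Prop :=
  ∀ (g : E → ℝ) (B : ℝ), Continuous g → (∀ x, |g x| ≤ B) → ∃ C : ℝ, ∀ η : ℝ, 0 < η →
    ∃ φ : E → ℝ, Continuous φ ∧ (∀ x, |φ x| ≤ C) ∧ ∫ x, |g x - φ x| ∂(Q + P) < η ∧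
      ∀ᶠ k in atTop, φ ∈ Φ k

lemma abs_sub_clamp_le {B s t : ℝ} (hs : |s| ≤ B) : |s - max (-B) (min B t)| ≤ |s - t| := by
  have h1 := abs_le.1 hs
  rcases le_total B t with h | h
  · rw [min_eq_left h, max_eq_right (by linarith), abs_of_nonpos (by linarith),
      abs_of_nonpos (by linarith)]
    linarith
  · rw [min_eq_right h]
    rcases le_total (-B) t with h2 | h2
    · rw [max_eq_right h2]
    · rw [max_eq_left h2, abs_of_nonneg (by linarith), abs_of_nonneg (by linarith)]
      linarith

lemma abs_clamp_le {B t : ℝ} (hB : 0 ≤ B) : |max (-B) (min B t)| ≤ B :=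
  abs_le.2 ⟨le_max_left _ _, max_le (by linarith) (min_le_left _ _)⟩

variable {Q P : Measure E} [IsProbabilityMeasure Q] [IsProbabilityMeasure P]
  {Φ : ℕ → Set (E → ℝ)} {α : ℝ}

/-- Every level below the divergence is exceeded by the objective of a single bounded function that
belongs to all but finitely many of the spaces `Φ k`. -/
lemma BoundedlyDense.exists_lt_objective [NormalSpace E] [BorelSpace E] [(Q + P).WeaklyRegular]
    (hΦ : BoundedlyDense Q P Φ) (hα0 : α ≠ 0) (hα1 : α ≠ 1) {L : ℝ}
    (hL : (L : EReal) < renyiDiv α Q P) :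
    ∃ (φ : E → ℝ) (C : ℝ), Continuous φ ∧ (∀ x, |φ x| ≤ C) ∧ (L : EReal) < objective α Q P φ ∧
      ∀ᶠ k in atTop, φ ∈ Φ k := by
  obtain ⟨g, B, hg, hB, hlt⟩ := exists_bounded_lt_objective hα0 hα1 hL
  have hne : Nonempty E := nonempty_of_isProbabilityMeasure Q
  have hB0 : 0 ≤ B := (abs_nonneg _).trans (hB hne.some)
  obtain ⟨η, hη, hηlt⟩ := exists_forall_lt_objective hg hB hlt
  have hgint : Integrable g (Q + P) :=
    Integrable.of_bound hg.aestronglyMeasurable B (ae_of_all _ hB)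
  obtain ⟨f, hf, hfint⟩ := hgint.exists_boundedContinuous_integral_sub_le (half_pos hη)
  set g' : E → ℝ := fun x => max (-B) (min B (f x)) with hg'
  have hg'c : Continuous g' := by have := f.continuous; fun_prop
  have hg'B : ∀ x, |g' x| ≤ B := fun x => abs_clamp_le hB0
  have hlt' : (L : EReal) < objective α Q P g' := by
    refine hηlt g' hg'c.measurable hg'B (lt_of_le_of_lt ?_ (half_lt_self hη))
    refine le_trans (integral_mono_of_nonneg (ae_of_all _ fun _ => abs_nonneg _)
      (hgint.sub hfint).norm (ae_of_all _ fun x => ?_)) hf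
    exact abs_sub_clamp_le (hB x)
  obtain ⟨C, hC⟩ := hΦ g' B hg'c hg'B
  obtain ⟨η', hη', hηlt'⟩ := exists_forall_lt_objective (C := max B C) hg'c.measurable
    (fun x => (hg'B x).trans (le_max_left _ _)) hlt'
  obtain ⟨φ, hφ, hφC, hφg, hφk⟩ := hC η' hη'
  exact ⟨φ, C, hφ, hφC, hηlt' φ hφ.measurable (fun x => (hφC x).trans (le_max_right _ _)) hφg, hφk⟩

variable {N : Type*} [MeasurableSpace N] {μ : Measure N} [IsProbabilityMeasure μ]
  {X Y : ℕ → N → E}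

/-- A compact family of functions with integrable exponential envelopes satisfies the upper bound:
the empirical objectives are uniformly close to the true ones, which the divergence bounds. -/
lemma upperBoundInProbability_of_compact [OpensMeasurableSpace E] {T : Type*} [TopologicalSpace T]
    [CompactSpace T] [T2Space T] [SecondCountableTopology T] (hα0 : α ≠ 0) (hα1 : α ≠ 1)
    (hX : IsIIDSample X Q μ) (hY : IsIIDSample Y P μ)
    (φ : C(E × T, ℝ)) {G H : E → ℝ} (hG : Integrable G Q) (hH : Integrable H P)
    (hφG : ∀ x t, Real.exp ((α - 1) * φ (x, t)) ≤ G x)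
    (hφH : ∀ x t, Real.exp (α * φ (x, t)) ≤ H x) :
    UpperBoundInProbability α Q P X Y μ (Set.range fun t x => φ (x, t)) := by
  intro δ hδ
  refine tendsto_measure_zero_of_subset (Eventually.of_forall fun n ω hω => ?_)
    (tendsto_measure_not_forall_objective_close hX hY α φ hG hH hφG hφH hδ)
  intro hcon
  refine hω ?_
  rintro _ ⟨t, rfl⟩
  have hφc : Continuous fun x => φ (x, t) := by fun_prop
  refine (hcon t).1.trans (add_le_add_left (objective_le_renyiDiv hα0 hα1 hφc.measurable ?_ ?_) _)
  · refine hG.mono' (by fun_prop : Continuous fun x =>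
      Real.exp ((α - 1) * φ (x, t))).measurable.aestronglyMeasurable (ae_of_all _ fun x => ?_)
    rw [Real.norm_eq_abs, Real.abs_exp]; exact hφG x t
  · refine hH.mono' (by fun_prop : Continuous fun x =>
      Real.exp (α * φ (x, t))).measurable.aestronglyMeasurable (ae_of_all _ fun x => ?_)
    rw [Real.norm_eq_abs, Real.abs_exp]; exact hφH x t

/-- The law of large numbers for the objective of one bounded function. -/
lemma tendsto_measure_objective_lt [OpensMeasurableSpace E]
    (hX : IsIIDSample X Q μ) (hY : IsIIDSample Y P μ) {φ : E → ℝ} {C : ℝ} (hφ : Continuous φ)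
    (hC : ∀ x, |φ x| ≤ C) {δ : ℝ} (hδ : 0 < δ) :
    Tendsto (fun n : ℕ => μ {ω | ¬ objective α Q P φ ≤ objective α
      (empiricalMeasure (fun i => X i ω) n) (empiricalMeasure (fun i => Y i ω) n) φ + (δ : EReal)})
      atTop (𝓝 0) := by
  have hexp : ∀ (c : ℝ) (x : E), Real.exp (c * φ x) ≤ Real.exp (|c| * C) := fun c x => by
    rw [Real.exp_le_exp]
    exact (le_abs_self _).trans ((abs_mul _ _).trans_le (by gcongr; exact hC x))
  refine tendsto_measure_zero_of_subset (Eventually.of_forall fun n ω hω => ?_)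
    (tendsto_measure_not_forall_objective_close (T := Unit) hX hY α
      ⟨fun z => φ z.1, by fun_prop⟩ (integrable_const _) (integrable_const _)
      (fun x _ => hexp _ x) (fun x _ => hexp _ x) hδ)
  exact fun hcon => hω (hcon ()).2

/-- Consistency from the upper bound on each `Φ k` and density of the sequence `Φ`. -/
theorem isConsistent_of_boundedlyDense [NormalSpace E] [BorelSpace E] [(Q + P).WeaklyRegular]
    (hα0 : α ≠ 0) (hα1 : α ≠ 1) (hX : IsIIDSample X Q μ) (hY : IsIIDSample Y P μ)
    (hdense : BoundedlyDense Q P Φ)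
    (hupper : ∀ k, UpperBoundInProbability α Q P X Y μ (Φ k)) :
    IsConsistent α Q P Φ X Y μ := by
  have hle : ∀ {φ : E → ℝ} {k n : ℕ} {ω : N}, φ ∈ Φ k →
      objective α (empiricalMeasure (fun i => X i ω) n) (empiricalMeasure (fun i => Y i ω) n) φ ≤
        estimator α (Φ k) X Y n ω := fun {φ k n ω} hφ => by
    unfold estimator
    exact le_iSup₂ (f := fun φ (_ : φ ∈ Φ k) => objective α
      (empiricalMeasure (fun i => X i ω) n) (empiricalMeasure (fun i => Y i ω) n) φ) φ hφ
  refine ⟨fun hfin δ hδ => ?_, fun htop M hM => ?_⟩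
  · have h0 := renyiDiv_nonneg (Q := Q) (P := P) hα0 hα1
    lift renyiDiv α Q P to ℝ using
      ⟨hfin.ne, (lt_of_lt_of_le EReal.bot_lt_zero h0).ne'⟩ with r hr
    have hlt : ((r - δ / 4 : ℝ) : EReal) < renyiDiv α Q P := by
      rw [← hr, EReal.coe_lt_coe_iff]; linarith
    obtain ⟨φ, C, hφ, hφC, hφL, hφk⟩ := hdense.exists_lt_objective hα0 hα1 hlt
    obtain ⟨K, hK⟩ := eventually_atTop.1 hφk
    refine ⟨K, fun k hk => tendsto_measure_zero_of_subset (Eventually.of_forall fun n ω hω => ?_)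
      (tendsto_measure_union_zero (hupper k (δ / 2) (half_pos hδ))
        (tendsto_measure_objective_lt (α := α) hX hY hφ hφC (δ := δ / 4) (by linarith)))⟩
    by_contra hcon
    simp only [Set.mem_union, Set.mem_ofPred_eq, not_or, not_not] at hcon
    obtain ⟨h1, h2⟩ := hcon
    have hub : estimator α (Φ k) X Y n ω ≤ ((r + δ / 2 : ℝ) : EReal) := by
      unfold estimator
      refine iSup₂_le fun ψ hψ => (h1 ψ hψ).trans ?_
      rw [← hr, ← EReal.coe_add]
    have hlb : ((r - δ / 4 : ℝ) : EReal) < estimator α (Φ k) X Y n ω + ((δ / 4 : ℝ) : EReal) :=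
      (hφL.trans_le h2).trans_le (add_le_add_left (hle (hK k hk)) _)
    have hdist : ENNReal.ofReal δ ≤ ((r : EReal) - estimator α (Φ k) X Y n ω).abs := hω
    generalize estimator α (Φ k) X Y n ω = e at hdist hub hlb
    induction e with
    | bot => simp at hlb
    | top => exact absurd hub (not_le.2 (EReal.coe_lt_top _))
    | coe e =>
      rw [EReal.coe_le_coe_iff] at hub
      rw [← EReal.coe_add, EReal.coe_lt_coe_iff] at hlb
      have h3 : ENNReal.ofReal δ ≤ ENNReal.ofReal |r - e| := by
        rwa [← EReal.coe_sub, EReal.abs_def] at hdist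
      rw [ENNReal.ofReal_le_ofReal_iff (abs_nonneg _)] at h3
      have : |r - e| < δ := abs_lt.2 ⟨by linarith, by linarith⟩
      linarith
  · have hlt : ((M + 1 : ℝ) : EReal) < renyiDiv α Q P := htop ▸ EReal.coe_lt_top _
    obtain ⟨φ, C, hφ, hφC, hφL, hφk⟩ := hdense.exists_lt_objective hα0 hα1 hlt
    obtain ⟨K, hK⟩ := eventually_atTop.1 hφk
    refine ⟨K, fun k hk => tendsto_measure_zero_of_subset (Eventually.of_forall fun n ω hω => ?_)
      (tendsto_measure_objective_lt (α := α) hX hY hφ hφC (δ := 1) one_pos)⟩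
    intro hcon
    have h1 : ((M + 1 : ℝ) : EReal) < (M : EReal) + ((1 : ℝ) : EReal) :=
      (hφL.trans_le hcon).trans_le (add_le_add_left ((hle (hK k hk)).trans hω) _)
    rw [← EReal.coe_add] at h1
    exact lt_irrefl _ h1

end Consistency

/-! ### Universal approximation by one hidden layer -/

section UniversalApproximation

lemma exists_eq_eval_of_iteratedDeriv_eq_zero (k : ℕ) :
    ∀ f : ℝ → ℝ, ContDiff ℝ k f → iteratedDeriv k f = 0 →
      ∃ p : Polynomial ℝ, ∀ x, f x = p.eval x := by
  have hprim : ∀ p : Polynomial ℝ, ∃ r : Polynomial ℝ, Polynomial.derivative r = p := by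
    intro p
    induction p using Polynomial.induction_on' with
    | add p q hp hq =>
      obtain ⟨r, rfl⟩ := hp
      obtain ⟨s, rfl⟩ := hq
      exact ⟨r + s, Polynomial.derivative_add⟩
    | monomial n a =>
      refine ⟨Polynomial.monomial (n + 1) (a / (n + 1)), ?_⟩
      rw [Polynomial.derivative_monomial]
      congr 1
      push_cast
      field_simp
  induction k with
  | zero =>
    intro f _ hf
    exact ⟨0, fun x => by simpa using congrFun hf x⟩
  | succ k ih =>
    intro f hf h0
    have hd : Differentiable ℝ f := hf.differentiable (by simp)
    rw [iteratedDeriv_succ'] at h0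
    obtain ⟨p, hp⟩ := ih (deriv f) (by
      have := (contDiff_succ_iff_deriv (n := (k : WithTop ℕ∞))).1 (by exact_mod_cast hf)
      exact this.2.2) h0
    obtain ⟨r, rfl⟩ := hprim p
    have hconst : ∀ x y, f x - r.eval x = f y - r.eval y :=
      is_const_of_deriv_eq_zero (hd.sub r.differentiable) fun x => by
        rw [deriv_fun_sub hd.differentiableAt r.differentiableAt, hp, Polynomial.deriv, sub_self]
    refine ⟨r + Polynomial.C (f 0 - r.eval 0), fun x => ?_⟩
    rw [Polynomial.eval_add, Polynomial.eval_C]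
    linarith [hconst x 0]

/-- A bounded nonconstant smooth function is not a polynomial, so no iterated derivative vanishes
identically. -/
lemma exists_iteratedDeriv_ne_zero {f : ℝ → ℝ} (hf : ∀ n : ℕ, ContDiff ℝ n f) {C : ℝ}
    (hC : ∀ x, |f x| ≤ C) {s t : ℝ} (hst : f s ≠ f t) (k : ℕ) :
    ∃ b, iteratedDeriv k f b ≠ 0 := by
  by_contra! hcon
  obtain ⟨p, hp⟩ := exists_eq_eval_of_iteratedDeriv_eq_zero k f (hf k) (funext hcon)
  have hdeg : p.degree ≤ 0 := p.isBoundedUnder_abs_atTop_iff.1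
    (isBoundedUnder_of ⟨C, fun x => by rw [← hp]; exact hC x⟩)
  rw [Polynomial.eq_C_of_degree_le_zero hdeg] at hp
  exact hst (by rw [hp s, hp t, Polynomial.eval_C, Polynomial.eval_C])

variable {m : ℕ}

lemma continuous_sum_mul (K : Set (Fin m → ℝ)) (w : Fin m → ℝ) :
    Continuous fun x : K => ∑ j, w j * x.1 j :=
  continuous_finsetSum _ fun j _ =>
    continuous_const.mul ((continuous_apply j).comp continuous_subtype_val)

section CompactDomain

variable {K : Set (Fin m → ℝ)} [CompactSpace K]

/-- The linear form `x ↦ w · x` on `K`. -/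
def linForm (K : Set (Fin m → ℝ)) (w : Fin m → ℝ) : C(K, ℝ) :=
  ⟨fun x => ∑ j, w j * x.1 j, continuous_sum_mul K w⟩

/-- The ridge function `x ↦ f (w · x + b)` on `K`. -/
def ridge (K : Set (Fin m → ℝ)) (f : C(ℝ, ℝ)) (w : Fin m → ℝ) (b : ℝ) : C(K, ℝ) :=
  ⟨fun x => f (linForm K w x + b), by fun_prop⟩

/-- The closed linear span in `C(K, ℝ)` of the ridge functions with profile `σ`. -/
def ridgeSpan (K : Set (Fin m → ℝ)) [CompactSpace K] (σ : C(ℝ, ℝ)) : Submodule ℝ C(K, ℝ) :=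
  (Submodule.span ℝ (Set.range fun z : (Fin m → ℝ) × ℝ => ridge K σ z.1 z.2)).topologicalClosure

lemma isClosed_ridgeSpan (σ : C(ℝ, ℝ)) : IsClosed (ridgeSpan K σ : Set C(K, ℝ)) :=
  Submodule.isClosed_topologicalClosure _

lemma ridge_mem_ridgeSpan (σ : C(ℝ, ℝ)) (w : Fin m → ℝ) (b : ℝ) :
    ridge K σ w b ∈ ridgeSpan K σ :=
  Submodule.le_topologicalClosure _ (Submodule.subset_span ⟨(w, b), rfl⟩)

lemma integral_mem_of_isClosed {F : Type*} [NormedAddCommGroup F] [NormedSpace ℝ F]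
    [CompleteSpace F] {V : Submodule ℝ F} (hV : IsClosed (V : Set F)) {D : ℝ → F}
    (hDc : Continuous D) (hDs : HasCompactSupport D) (hD : ∀ y, D y ∈ V) : ∫ y, D y ∈ V := by
  have : CompleteSpace V := hV.completeSpace_coe
  have hs : HasCompactSupport (fun y => (⟨D y, hD y⟩ : V)) :=
    hDs.mono fun y hy hy0 => hy (Subtype.ext hy0)
  have hint : Integrable (fun y => (⟨D y, hD y⟩ : V)) :=
    Continuous.integrable_of_hasCompactSupport (hDc.subtype_mk hD) hs
  have h := V.subtypeL.integral_comp_comm hint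
  change ∫ y, D y = _ at h
  rw [h]
  exact Subtype.property _

/-- A mollified ridge function is a Bochner integral of translates of the ridge function, so it
stays in the closed span. -/
lemma ridge_mollification_mem (σ f ρ : C(ℝ, ℝ)) (hρ : HasCompactSupport ρ)
    (hf : ∀ t, f t = ∫ y, ρ y * σ (t - y)) (w : Fin m → ℝ) (b : ℝ) :
    ridge K f w b ∈ ridgeSpan K σ := by
  have hR : Continuous fun y => ridge K σ w (b - y) :=
    ContinuousMap.continuous_of_continuous_uncurry _ (by
      change Continuous fun z : ℝ × K => σ (linForm K w z.2 + (b - z.1))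
      fun_prop)
  have hc : Continuous fun y => ρ y • ridge K σ w (b - y) := ρ.continuous.smul hR
  have hs : HasCompactSupport fun y => ρ y • ridge K σ w (b - y) := hρ.smul_right
  have hint : Integrable fun y => ρ y • ridge K σ w (b - y) := hc.integrable_of_hasCompactSupport hs
  have heq : ridge K f w b = ∫ y, ρ y • ridge K σ w (b - y) := by
    ext x
    refine Eq.trans ?_ ((ContinuousMap.evalCLM ℝ (M := ℝ) x).integral_comp_comm hint)
    change f (linForm K w x + b) = ∫ y, ρ y * σ (linForm K w x + (b - y))
    simp only [hf, add_sub_assoc]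
  rw [heq]
  exact integral_mem_of_isClosed (isClosed_ridgeSpan σ) hc hs fun y =>
    Submodule.smul_mem _ _ (ridge_mem_ridgeSpan σ w _)

/-- A closed subspace containing a curve `t ↦ D (t, ·)` contains its derivative. -/
lemma curry_deriv_mem {V : Submodule ℝ C(K, ℝ)} (hV : IsClosed (V : Set C(K, ℝ)))
    (D D' : C(ℝ × K, ℝ)) (hd : ∀ t x, HasDerivAt (fun s => D (s, x)) (D' (t, x)) t)
    (hD : ∀ t, D.curry t ∈ V) (t : ℝ) : D'.curry t ∈ V := by
  have hcl : D'.curry t ∈ closure (V : Set C(K, ℝ)) := by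
    refine Metric.mem_closure_iff.2 fun ε hε => ?_
    obtain ⟨δ, hδ, hclose⟩ := Metric.continuous_iff.1 D'.curry.continuous t (ε / 2) (half_pos hε)
    refine ⟨(δ / 2)⁻¹ • (D.curry (t + δ / 2) - D.curry t),
      V.smul_mem _ (V.sub_mem (hD _) (hD _)), lt_of_le_of_lt ?_ (half_lt_self hε)⟩
    refine (ContinuousMap.dist_le (half_pos hε).le).2 fun x => ?_
    -- mean value theorem in the parameter, for each fixed `x`
    obtain ⟨c, hc, hslope⟩ := exists_hasDerivAt_eq_slope (fun s => D (s, x)) (fun s => D' (s, x))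
      (show t < t + δ / 2 by linarith) (by fun_prop) (fun s _ => hd s x)
    have h1 : ((δ / 2)⁻¹ • (D.curry (t + δ / 2) - D.curry t)) x = D' (c, x) := by
      rw [hslope, add_sub_cancel_left]
      exact (div_eq_inv_mul _ _).symm
    rw [h1]
    have h2 := hclose c (by
      rw [Real.dist_eq, abs_of_pos (by linarith [hc.1])]
      linarith [hc.2])
    rw [dist_comm]
    exact (ContinuousMap.dist_apply_le_dist x).trans h2.le
  rwa [hV.closure_eq] at hcl

/-- Powers of linear forms are obtained by differentiating `t ↦ f (t (w · x) + b)` at `t = 0`. -/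
lemma linForm_pow_mem {V : Submodule ℝ C(K, ℝ)} (hV : IsClosed (V : Set C(K, ℝ))) {f : C(ℝ, ℝ)}
    (hf : ∀ n : ℕ, ContDiff ℝ n f) (hne : ∀ k, ∃ b, iteratedDeriv k f b ≠ 0)
    (hmem : ∀ w b, ridge K f w b ∈ V) (w : Fin m → ℝ) (k : ℕ) : linForm K w ^ k ∈ V := by
  obtain ⟨b, hb⟩ := hne k
  have hcont : ∀ k, Continuous (iteratedDeriv k f) := fun k =>
    (hf k).continuous_iteratedDeriv k le_rfl
  let D : ℕ → C(ℝ × K, ℝ) := fun k =>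
    ⟨fun z => linForm K w z.2 ^ k * iteratedDeriv k f (z.1 * linForm K w z.2 + b), by
      have := hcont k
      fun_prop⟩
  have key : ∀ k t, (D k).curry t ∈ V := by
    intro k
    induction k with
    | zero =>
      intro t
      convert hmem (t • w) b using 1
      ext x
      simp [D, ridge, linForm, Finset.mul_sum, mul_assoc]
    | succ k ih =>
      refine curry_deriv_mem hV (D k) (D (k + 1)) (fun t x => ?_) ih
      have h1 : HasDerivAt (iteratedDeriv k f) (iteratedDeriv (k + 1) f (t * linForm K w x + b))
          (t * linForm K w x + b) := by
        rw [iteratedDeriv_succ]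
        exact ((hf (k + 1)).differentiable_iteratedDeriv k (by norm_cast; omega)
          _).hasDerivAt
      have h2 : HasDerivAt (fun s => s * linForm K w x + b) (linForm K w x) t := by
        simpa using ((hasDerivAt_id t).mul_const (linForm K w x)).add_const b
      have h3 := (h1.comp t h2).const_mul (linForm K w x ^ k)
      refine HasDerivAt.congr_deriv h3 ?_
      change _ = linForm K w x ^ (k + 1) * iteratedDeriv (k + 1) f (t * linForm K w x + b)
      ring
  have h0 : (D k).curry 0 = iteratedDeriv k f b • linForm K w ^ k := by
    ext x
    simp [D, mul_comm]
  have h1 := V.smul_mem (iteratedDeriv k f b)⁻¹ (h0 ▸ key k 0)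
  rwa [smul_smul, inv_mul_cancel₀ hb, one_smul] at h1

lemma exp_apply (f : C(K, ℝ)) (x : K) : NormedSpace.exp f x = Real.exp (f x) := by
  have h := NormedSpace.map_exp (ContinuousMap.evalAlgHom ℝ ℝ x)
    (continuous_eval_const x) f
  rw [Real.exp_eq_exp_ℝ]
  exact h

/-- Exponentials of linear forms span a point-separating subalgebra, so a closed subspace with all
powers of linear forms is everything, by the Stone–Weierstrass theorem. -/
lemma eq_top_of_linForm_pow_mem {V : Submodule ℝ C(K, ℝ)} (hV : IsClosed (V : Set C(K, ℝ)))
    (hmem : ∀ w k, linForm K w ^ k ∈ V) : V = ⊤ := by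
  have hexp : ∀ w, NormedSpace.exp (linForm K w) ∈ V := fun w => by
    have hs := NormedSpace.exp_series_hasSum_exp' (𝕂 := ℝ) (linForm K w)
    exact hV.mem_of_tendsto hs (Eventually.of_forall fun s =>
      V.sum_mem fun k _ => V.smul_mem _ (hmem w k))
  let M : Submonoid C(K, ℝ) :=
    { carrier := Set.range fun w => NormedSpace.exp (linForm K w)
      one_mem' := ⟨0, by ext x; simp [exp_apply, linForm]⟩
      mul_mem' := by
        rintro _ _ ⟨w, rfl⟩ ⟨w', rfl⟩
        refine ⟨w + w', ?_⟩
        ext x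
        simp [exp_apply, linForm, ← Real.exp_add, add_mul, Finset.sum_add_distrib] }
  have hspan : (Algebra.adjoin ℝ (M : Set C(K, ℝ))).toSubmodule ≤ V := by
    rw [Algebra.adjoin_eq_span, Submonoid.closure_eq, Submodule.span_le]
    rintro _ ⟨w, rfl⟩
    exact hexp w
  have hsep : (Algebra.adjoin ℝ (M : Set C(K, ℝ))).SeparatesPoints := by
    intro x y hxy
    obtain ⟨j, hj⟩ : ∃ j, x.1 j ≠ y.1 j := by
      by_contra! h
      exact hxy (Subtype.ext (funext h))
    refine ⟨_, ⟨NormedSpace.exp (linForm K (Pi.single j 1)),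
      Algebra.subset_adjoin ⟨Pi.single j 1, rfl⟩, rfl⟩, ?_⟩
    simp only [exp_apply, linForm, ContinuousMap.coe_mk]
    intro h
    have := Real.exp_injective h
    simp [Pi.single_apply] at this
    exact hj this
  have htop := ContinuousMap.subalgebra_topologicalClosure_eq_top_of_separatesPoints _ hsep
  rw [eq_top_iff]
  intro g _
  have hg : g ∈ (Algebra.adjoin ℝ (M : Set C(K, ℝ))).topologicalClosure := htop ▸ trivial
  have hg' : g ∈ closure ((Algebra.adjoin ℝ (M : Set C(K, ℝ)) : Subalgebra ℝ C(K, ℝ)) :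
      Set C(K, ℝ)) := hg
  exact hV.closure_subset_iff.2 (fun f hf => hspan hf) hg'

/-- Some mollification of a nonconstant continuous function is nonconstant; it is smooth, and
bounded by the same constant. -/
lemma exists_smooth_mollification (σ : C(ℝ, ℝ)) {C : ℝ} (hC : ∀ t, |σ t| ≤ C) {s t : ℝ}
    (hst : σ s ≠ σ t) : ∃ f ρ : C(ℝ, ℝ), HasCompactSupport ρ ∧
      (∀ t, f t = ∫ y, ρ y * σ (t - y)) ∧ (∀ n : ℕ, ContDiff ℝ n f) ∧ (∀ t, |f t| ≤ C) ∧
      f s ≠ f t := by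
  let φ : ℕ → ContDiffBump (0 : ℝ) := fun n =>
    ⟨1 / (2 * (n + 1)), 1 / (n + 1), by positivity, by
      have : (0 : ℝ) < n + 1 := by positivity
      gcongr
      linarith⟩
  have hφ : Tendsto (fun n => (φ n).rOut) atTop (𝓝 0) := tendsto_one_div_add_atTop_nhds_zero_nat
  have hlim := fun x => ContDiffBump.convolution_tendsto_right_of_continuous (μ := volume) hφ
    σ.continuous x
  obtain ⟨n, hn⟩ := (((hlim s).sub (hlim t)).eventually_ne (sub_ne_zero.2 hst)).exists
  rw [sub_ne_zero] at hn
  have hsmooth : ∀ k : ℕ, ContDiff ℝ k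
      (convolution ((φ n).normed volume) σ (ContinuousLinearMap.lsmul ℝ ℝ) volume) := fun k => by
    have := HasCompactSupport.contDiff_convolution_left (n := (k : ℕ∞)) (μ := volume)
      (ContinuousLinearMap.lsmul ℝ ℝ) ((φ n).hasCompactSupport_normed (μ := volume))
      (φ n).contDiff_normed (σ.continuous.locallyIntegrable)
    exact_mod_cast this
  refine ⟨⟨_, (hsmooth 0).continuous⟩, ⟨(φ n).normed volume, (φ n).continuous_normed⟩,
    (φ n).hasCompactSupport_normed, fun x => by simp [convolution_def], hsmooth, fun x => ?_, hn⟩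
  simp only [ContinuousMap.coe_mk, convolution_def, ContinuousLinearMap.lsmul_apply, smul_eq_mul]
  calc |∫ y, (φ n).normed volume y * σ (x - y)|
      ≤ ∫ y, |(φ n).normed volume y * σ (x - y)| := abs_integral_le_integral_abs
    _ ≤ ∫ y, (φ n).normed volume y * C := by
        refine integral_mono_of_nonneg (ae_of_all _ fun _ => abs_nonneg _)
          ((φ n).integrable_normed.mul_const C) (ae_of_all _ fun y => ?_)
        simp only
        rw [abs_mul, abs_of_nonneg ((φ n).nonneg_normed y)]
        exact mul_le_mul_of_nonneg_left (hC _) ((φ n).nonneg_normed y)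
    _ = C := by rw [integral_mul_const, (φ n).integral_normed, one_mul]

lemma ridgeSpan_eq_top (σ : C(ℝ, ℝ)) {C : ℝ} (hC : ∀ t, |σ t| ≤ C) {s t : ℝ}
    (hst : σ s ≠ σ t) : ridgeSpan K σ = ⊤ := by
  obtain ⟨f, ρ, hρ, hfρ, hsmooth, hfC, hfst⟩ := exists_smooth_mollification σ hC hst
  exact eq_top_of_linForm_pow_mem (isClosed_ridgeSpan σ) fun w k =>
    linForm_pow_mem (isClosed_ridgeSpan σ) hsmooth
      (exists_iteratedDeriv_ne_zero hsmooth hfC hfst) (ridge_mollification_mem σ f ρ hρ hfρ) w k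

end CompactDomain

/-- A one-hidden-layer network with `n` units. The coefficients are indexed by `ℕ` so that the
network can be padded to any larger width. -/
def shallow (σ : ℝ → ℝ) (n : ℕ) (c : ℕ → ℝ) (w : ℕ → Fin m → ℝ) (b : ℕ → ℝ)
    (x : Fin m → ℝ) : ℝ :=
  ∑ i ∈ Finset.range n, c i * σ ((∑ j, w i j * x j) + b i)

/-- Universal approximation by one-hidden-layer networks with a bounded continuous nonconstant
activation. -/
theorem exists_shallow_close {K : Set (Fin m → ℝ)} {σ : ℝ → ℝ} (hσ : Continuous σ) {C : ℝ}
    (hC : ∀ t, |σ t| ≤ C) {s t : ℝ} (hst : σ s ≠ σ t) (hK : IsCompact K) {g : (Fin m → ℝ) → ℝ}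
    (hg : ContinuousOn g K) {ε : ℝ} (hε : 0 < ε) : ∃ n c w b, ∀ x ∈ K, |g x - shallow σ n c w b x| < ε := by
  have : CompactSpace K := isCompact_iff_compactSpace.1 hK
  let σ' : C(ℝ, ℝ) := ⟨σ, hσ⟩
  let g' : C(K, ℝ) := ⟨fun x => g x, hg.domRestrict⟩
  have hmem : g' ∈ ridgeSpan K σ' := by
    rw [ridgeSpan_eq_top σ' hC hst]; trivial
  obtain ⟨h, hh, hdist⟩ := Metric.mem_closure_iff.1
    (show g' ∈ closure ((Submodule.span ℝ (Set.range fun z : (Fin m → ℝ) × ℝ =>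
      ridge K σ' z.1 z.2) : Submodule ℝ C(K, ℝ)) : Set C(K, ℝ)) from hmem) ε hε
  obtain ⟨n, c, z, rfl⟩ := Submodule.mem_span_set'.1 hh
  choose p hp using fun i => (z i).2
  refine ⟨n, fun i => if hi : i < n then c ⟨i, hi⟩ else 0,
    fun i => if hi : i < n then (p ⟨i, hi⟩).1 else 0,
    fun i => if hi : i < n then (p ⟨i, hi⟩).2 else 0, fun x hx => ?_⟩
  have h1 := (ContinuousMap.dist_apply_le_dist (f := g') (g := _) ⟨x, hx⟩).trans_lt hdist
  rw [Real.dist_eq] at h1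
  refine lt_of_eq_of_lt ?_ h1
  congr 2
  rw [ContinuousMap.sum_apply]
  unfold shallow
  rw [← Fin.sum_univ_eq_sum_range (fun i => (if hi : i < n then c ⟨i, hi⟩ else 0) *
    σ ((∑ j, (if hi : i < n then (p ⟨i, hi⟩).1 else 0) j * x j) +
      (if hi : i < n then (p ⟨i, hi⟩).2 else 0)))]
  refine Finset.sum_congr rfl fun i _ => ?_
  simp only [Fin.is_lt, dite_true, Fin.eta, ContinuousMap.smul_apply, smul_eq_mul, ← hp]
  rfl

end UniversalApproximation

/-! ### Continuity, compactness and growth of networks -/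

namespace Architecture

variable {m : ℕ}

lemma finite_paramIdx : ∀ {m : ℕ} (A : Architecture m), Finite A.ParamIdx
  | m, output _ => inferInstanceAs (Finite (Option (Fin m)))
  | m, hidden n _ rest =>
    have := finite_paramIdx rest
    inferInstanceAs (Finite ((Fin n × Option (Fin m)) ⊕ rest.ParamIdx))

instance (A : Architecture m) : Finite A.ParamIdx := finite_paramIdx A

lemma continuous_eval : ∀ {m : ℕ} (A : Architecture m), A.ContinuousActivations →
    Continuous fun z : (Fin m → ℝ) × A.Params => A.eval z.2 z.1
  | m, output _, _ => by
    have h : Continuous fun z : (Fin m → ℝ) × (Option (Fin m) → ℝ) =>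
        (∑ j, z.2 (some j) * z.1 j) + z.2 none := by fun_prop
    exact h
  | m, hidden n σ rest, ⟨hσ, hrest⟩ => by
    have ih := continuous_eval rest hrest
    have h : Continuous fun z : (Fin m → ℝ) × ((Fin n × Option (Fin m)) ⊕ rest.ParamIdx → ℝ) =>
        rest.eval (fun i => z.2 (Sum.inr i))
          (σ fun i => (∑ j, z.2 (Sum.inl (i, some j)) * z.1 j) + z.2 (Sum.inl (i, none))) :=
      ih.comp ((hσ.comp (by fun_prop)).prodMk (by fun_prop))
    exact h

lemma isCompact_paramBox (A : Architecture m) (r : ℝ) : IsCompact (A.paramBox r) := by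
  have : A.paramBox r = Set.univ.pi fun _ => Set.Icc (-r) r := by
    ext θ
    exact ⟨fun h i _ => h i, fun h i => h i trivial⟩
  rw [this]
  exact isCompact_univ_pi fun _ => isCompact_Icc

/-- Every parameter vector lies in the boxes `[-a k, a k]` with `k` large. -/
lemma eventually_mem_paramBox (A : Architecture m) (θ : A.Params) {a : ℕ → ℝ}
    (ha : Tendsto a atTop atTop) : ∀ᶠ k in atTop, θ ∈ A.paramBox (a k) := by
  have h : ∀ᶠ k in atTop, ∀ i, |θ i| ≤ a k :=
    eventually_all.2 fun i => ha.eventually_ge_atTop _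
  exact h.mono fun k hk i => abs_le.1 (hk i)

/-- Parameters of a network from those of its first layer and of the rest. -/
def consParams {n : ℕ} {σ : (Fin n → ℝ) → (Fin n → ℝ)} {rest : Architecture n}
    (W : Fin n → Fin m → ℝ) (β : Fin n → ℝ) (θ : rest.Params) :
    (hidden (m := m) n σ rest).Params :=
  Sum.elim (fun z : Fin n × Option (Fin m) => z.2.elim (β z.1) (W z.1)) θ

/-- Parameters of the final affine map. -/
def outParams (W : Fin m → ℝ) (β : ℝ) : (output m).Params :=
  fun z : Option (Fin m) => z.elim β W

lemma eval_consParams {n : ℕ} {σ : (Fin n → ℝ) → (Fin n → ℝ)} {rest : Architecture n}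
    (W : Fin n → Fin m → ℝ) (β : Fin n → ℝ) (θ : rest.Params) (x : Fin m → ℝ) :
    (hidden n σ rest).eval (consParams W β θ) x =
      rest.eval θ (σ fun i => (∑ j, W i j * x j) + β i) := rfl

lemma eval_outParams (W : Fin m → ℝ) (β : ℝ) (x : Fin m → ℝ) :
    (output m).eval (outParams W β) x = (∑ j, W j * x j) + β := rfl

lemma consParams_mem_paramBox {n : ℕ} {σ : (Fin n → ℝ) → (Fin n → ℝ)} {rest : Architecture n}
    {W : Fin n → Fin m → ℝ} {β : Fin n → ℝ} {θ : rest.Params} {r : ℝ} (hW : ∀ i j, |W i j| ≤ r)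
    (hβ : ∀ i, |β i| ≤ r) (hθ : θ ∈ rest.paramBox r) :
    consParams W β θ ∈ (hidden (m := m) n σ rest).paramBox r := by
  have h : ∀ z : (Fin n × Option (Fin m)) ⊕ rest.ParamIdx,
      (Sum.elim (fun z : Fin n × Option (Fin m) => z.2.elim (β z.1) (W z.1)) θ) z ∈
        Set.Icc (-r) r := by
    rintro (⟨i, _ | j⟩ | z)
    · exact abs_le.1 (hβ i)
    · exact abs_le.1 (hW i j)
    · exact hθ z
  exact h

lemma outParams_mem_paramBox {W : Fin m → ℝ} {β r : ℝ} (hW : ∀ j, |W j| ≤ r) (hβ : |β| ≤ r) :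
    outParams W β ∈ (output m).paramBox r := by
  have h : ∀ z : Option (Fin m), (z.elim β W : ℝ) ∈ Set.Icc (-r) r := by
    rintro (_ | j)
    · exact abs_le.1 hβ
    · exact abs_le.1 (hW j)
  exact h

lemma continuousActivations_uniform {act : (n : ℕ) → (Fin n → ℝ) → (Fin n → ℝ)}
    (hact : ∀ n, Continuous (act n)) :
    ∀ (m : ℕ) (ws : List ℕ), (uniform act m ws).ContinuousActivations
  | _, [] => trivial
  | _, n :: ws => ⟨hact n, continuousActivations_uniform hact n ws⟩

lemma abs_sum_mul_add_le {x W : Fin m → ℝ} {β r : ℝ} (hW : ∀ j, |W j| ≤ r) (hβ : |β| ≤ r) :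
    |(∑ j, W j * x j) + β| ≤ r * (m + 1) * (1 + ‖x‖) := by
  have hr : 0 ≤ r := (abs_nonneg _).trans hβ
  calc |(∑ j, W j * x j) + β| ≤ |∑ j, W j * x j| + |β| := abs_add_le _ _
    _ ≤ (∑ j, |W j * x j|) + r := add_le_add (Finset.abs_sum_le_sum_abs _ _) hβ
    _ ≤ (∑ _j : Fin m, r * ‖x‖) + r := by
        gcongr with j _
        rw [abs_mul]
        exact mul_le_mul (hW j) (norm_le_pi_norm x j) (abs_nonneg _) hr
    _ = r * (m * ‖x‖ + 1) := by simp; ring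
    _ ≤ r * ((m + 1) * (1 + ‖x‖)) := by
        gcongr
        nlinarith [norm_nonneg x, (Nat.cast_nonneg m : (0 : ℝ) ≤ m)]
    _ = _ := by ring

/-- Networks with bounded parameters grow at most linearly if the activations do not increase the
sup norm. -/
lemma exists_eval_uniform_le {act : (n : ℕ) → (Fin n → ℝ) → (Fin n → ℝ)}
    (hact : ∀ n x, ‖act n x‖ ≤ ‖x‖) (r : ℝ) :
    ∀ (ws : List ℕ) (m : ℕ), ∃ B : ℝ, 0 ≤ B ∧ ∀ θ ∈ (uniform act m ws).paramBox r,
      ∀ x, |(uniform act m ws).eval θ x| ≤ B * (1 + ‖x‖)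
  | [], m => by
    refine ⟨|r| * (m + 1), by positivity, fun θ hθ x => ?_⟩
    have hθ' : ∀ z : Option (Fin m), |(θ : Option (Fin m) → ℝ) z| ≤ |r| := fun z =>
      (abs_le.2 (hθ z)).trans (le_abs_self r)
    exact abs_sum_mul_add_le (W := fun j => (θ : Option (Fin m) → ℝ) (some j))
      (fun j => hθ' _) (hθ' none)
  | n :: ws, m => by
    obtain ⟨B, hB, h⟩ := exists_eval_uniform_le hact r ws n
    refine ⟨B * (1 + |r| * (m + 1)), by positivity, fun θ hθ x => ?_⟩
    let θ' : (Fin n × Option (Fin m)) ⊕ (uniform act n ws).ParamIdx → ℝ := θ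
    have hθ' : ∀ z, |θ' z| ≤ |r| := fun z => (abs_le.2 (hθ z)).trans (le_abs_self r)
    let y : Fin n → ℝ := fun i => (∑ j, θ' (Sum.inl (i, some j)) * x j) + θ' (Sum.inl (i, none))
    have hy : ‖y‖ ≤ |r| * (m + 1) * (1 + ‖x‖) :=
      (pi_norm_le_iff_of_nonneg (by positivity)).2 fun i =>
        abs_sum_mul_add_le (W := fun j => θ' (Sum.inl (i, some j))) (fun j => hθ' _) (hθ' _)
    have h1 : |(uniform act m (n :: ws)).eval θ x| ≤ B * (1 + ‖act n y‖) :=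
      h (fun i => θ' (Sum.inr i)) (fun i => hθ (Sum.inr i)) (act n y)
    refine h1.trans ?_
    rw [mul_assoc]
    gcongr
    have := (hact n y).trans hy
    nlinarith [norm_nonneg x]

end Architecture

section Envelopes

variable {m : ℕ}

lemma FiniteMGF.integrable_exp_norm {Q : Measure (Fin m → ℝ)} [IsProbabilityMeasure Q]
    (hQ : FiniteMGF Q) {c : ℝ} (hc : 0 ≤ c) : Integrable (fun x => Real.exp (c * ‖x‖)) Q := by
  have hint : Integrable (fun x : Fin m → ℝ => 1 + ∑ j, (Real.exp (Pi.single j c ⬝ᵥ x) +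
      Real.exp (Pi.single j (-c) ⬝ᵥ x))) Q :=
    (integrable_const _).add (integrable_finsetSum _ fun j _ => (hQ _).add (hQ _))
  refine hint.mono' (by fun_prop) (ae_of_all _ fun x => ?_)
  rw [Real.norm_eq_abs, Real.abs_exp]
  have hpos : ∀ j : Fin m, 0 ≤ Real.exp (Pi.single j c ⬝ᵥ x) +
      Real.exp (Pi.single j (-c) ⬝ᵥ x) := fun j => by positivity
  rcases Nat.eq_zero_or_pos m with rfl | hm
  · have : ‖x‖ = 0 := by rw [Subsingleton.elim x 0, norm_zero]
    simp [this]
  · have : Nonempty (Fin m) := ⟨⟨0, hm⟩⟩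
    -- the sup norm is attained at some coordinate
    obtain ⟨j, hj⟩ : ∃ j, ‖x‖ ≤ |x j| := by
      obtain ⟨j, hj⟩ := Finite.exists_max fun j => |x j|
      exact ⟨j, (pi_norm_le_iff_of_nonneg (abs_nonneg _)).2 hj⟩
    have h1 := Finset.single_le_sum (fun j _ => hpos j) (Finset.mem_univ j)
    simp only [single_dotProduct] at h1
    have h2 : Real.exp (c * ‖x‖) ≤ Real.exp (c * x j) + Real.exp (-c * x j) := by
      rcases abs_cases (x j) with ⟨h, -⟩ | ⟨h, -⟩
      · refine le_trans ?_ (le_add_of_nonneg_right (Real.exp_pos _).le)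
        gcongr; exact h ▸ hj
      · refine le_trans ?_ (le_add_of_nonneg_left (Real.exp_pos _).le)
        rw [neg_mul, ← mul_neg]
        gcongr; exact h ▸ hj
    simp only [single_dotProduct]
    linarith

variable {E : Type*} [TopologicalSpace E] [MeasurableSpace E] [OpensMeasurableSpace E]
  {Q P : Measure E} [IsProbabilityMeasure Q] [IsProbabilityMeasure P]
  {N : Type*} [MeasurableSpace N] {μ : Measure N} [IsProbabilityMeasure μ] {X Y : ℕ → N → E}
  {α : ℝ}

/-- The functions computed by one architecture with parameters in a compact set satisfy the upper
bound, provided that they have a common exponentially integrable bound. -/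
lemma upperBoundInProbability_eval (hα0 : α ≠ 0) (hα1 : α ≠ 1) (hX : IsIIDSample X Q μ)
    (hY : IsIIDSample Y P μ) {ι : E → Fin m → ℝ} (hι : Continuous ι) (A : Architecture m)
    (hA : A.ContinuousActivations) {S : Set A.Params} (hS : IsCompact S) {b : E → ℝ}
    (hb : ∀ θ ∈ S, ∀ x, |A.eval θ (ι x)| ≤ b x)
    (hQ : Integrable (fun x => Real.exp (|α - 1| * b x)) Q)
    (hP : Integrable (fun x => Real.exp (|α| * b x)) P) :
    UpperBoundInProbability α Q P X Y μ {φ | ∃ θ ∈ S, φ = fun x => A.eval θ (ι x)} := by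
  have : CompactSpace S := isCompact_iff_compactSpace.1 hS
  have hc : Continuous fun z : E × S => A.eval z.2.1 (ι z.1) :=
    (A.continuous_eval hA).comp ((hι.comp continuous_fst).prodMk
      (continuous_subtype_val.comp continuous_snd))
  have hexp : ∀ (c : ℝ) (x : E) (t : S),
      Real.exp (c * A.eval t.1 (ι x)) ≤ Real.exp (|c| * b x) := fun c x t => by
    rw [Real.exp_le_exp]
    exact (le_abs_self _).trans ((abs_mul _ _).trans_le (by gcongr; exact hb t.1 t.2 x))
  refine (upperBoundInProbability_of_compact hα0 hα1 hX hY ⟨_, hc⟩ hQ hP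
    (fun x t => hexp _ x t) (fun x t => hexp _ x t)).mono ?_
  rintro φ ⟨θ, hθ, rfl⟩
  exact ⟨⟨θ, hθ⟩, rfl⟩

/-- On a compact space continuity alone provides the exponentially integrable bound. -/
lemma upperBoundInProbability_eval_of_compactSpace [CompactSpace E] (hα0 : α ≠ 0) (hα1 : α ≠ 1)
    (hX : IsIIDSample X Q μ) (hY : IsIIDSample Y P μ) {ι : E → Fin m → ℝ} (hι : Continuous ι)
    (A : Architecture m) (hA : A.ContinuousActivations) {S : Set A.Params} (hS : IsCompact S) :
    UpperBoundInProbability α Q P X Y μ {φ | ∃ θ ∈ S, φ = fun x => A.eval θ (ι x)} := by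
  have hc : Continuous fun z : E × A.Params => A.eval z.2 (ι z.1) :=
    (A.continuous_eval hA).comp ((hι.comp continuous_fst).prodMk continuous_snd)
  obtain ⟨C, hC⟩ := (isCompact_univ.prod hS).exists_bound_of_continuousOn hc.continuousOn
  exact upperBoundInProbability_eval hα0 hα1 hX hY hι A hA hS (b := fun _ => C)
    (fun θ hθ x => hC (x, θ) ⟨Set.mem_univ _, hθ⟩) (integrable_const _) (integrable_const _)

end Envelopes

section EuclideanUpperBound

variable {m : ℕ} {Q P : Measure (Fin m → ℝ)} [IsProbabilityMeasure Q] [IsProbabilityMeasure P]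
  {N : Type*} [MeasurableSpace N] {μ : Measure N} [IsProbabilityMeasure μ]
  {X Y : ℕ → N → Fin m → ℝ} {α : ℝ}

lemma networks_eq_biUnion (act : (n : ℕ) → (Fin n → ℝ) → (Fin n → ℝ)) (W : Set (List ℕ)) (r : ℝ) :
    networks m act W r = ⋃ ws ∈ W, {φ | ∃ θ ∈ (Architecture.uniform act m ws).paramBox r,
      φ = fun x => (Architecture.uniform act m ws).eval θ x} := by
  ext φ
  simp [networks]

lemma finite_lists_le (k : ℕ) : {ws : List ℕ | ws.length ≤ k ∧ ∀ w ∈ ws, w ≤ k}.Finite := by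
  refine (List.finite_length_le (Fin (k + 1)) k).image (List.map Fin.val) |>.subset ?_
  rintro ws ⟨hlen, hws⟩
  refine ⟨ws.pmap (fun w hw => ⟨w, hw⟩) (fun w hw => Nat.lt_succ_of_le (hws w hw)), ?_, ?_⟩
  · simpa using hlen
  · simp [List.map_pmap]

lemma upperBoundInProbability_networks_of_finiteMGF (hα0 : α ≠ 0) (hα1 : α ≠ 1)
    (hX : IsIIDSample X Q μ) (hY : IsIIDSample Y P μ) (hQ : FiniteMGF Q) (hP : FiniteMGF P)
    {act : (n : ℕ) → (Fin n → ℝ) → (Fin n → ℝ)} (hactc : ∀ n, Continuous (act n))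
    (hact : ∀ n x, ‖act n x‖ ≤ ‖x‖) {W : Set (List ℕ)} (hW : W.Finite) (r : ℝ) :
    UpperBoundInProbability α Q P X Y μ (networks m act W r) := by
  rw [networks_eq_biUnion]
  refine UpperBoundInProbability.biUnion hW fun ws _ => ?_
  obtain ⟨B, hB, hle⟩ := Architecture.exists_eval_uniform_le hact r ws m
  have hint : ∀ {R : Measure (Fin m → ℝ)} [IsProbabilityMeasure R], FiniteMGF R → ∀ c : ℝ,
      Integrable (fun x => Real.exp (|c| * (B * (1 + ‖x‖)))) R := fun {R} _ hR c => by
    have h := (hR.integrable_exp_norm (c := |c| * B) (by positivity)).const_mul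
      (Real.exp (|c| * B))
    refine h.congr (ae_of_all _ fun x => ?_)
    simp only
    rw [← Real.exp_add]
    congr 1; ring
  exact upperBoundInProbability_eval hα0 hα1 hX hY continuous_id _
    (Architecture.continuousActivations_uniform hactc m ws) (Architecture.isCompact_paramBox _ r)
    (b := fun x => B * (1 + ‖x‖)) (fun θ hθ x => hle θ hθ x) (hint hQ _) (hint hP _)

/-- With bounded activations, everything after the first hidden layer is evaluated on a compact
set, so no moment condition is needed. -/
lemma upperBoundInProbability_networks_of_bounded (hα0 : α ≠ 0) (hα1 : α ≠ 1)
    (hX : IsIIDSample X Q μ) (hY : IsIIDSample Y P μ) {σ : ℝ → ℝ} (hσ : Continuous σ) {C : ℝ}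
    (hC : ∀ t, |σ t| ≤ C) (n : ℕ) (ws : List ℕ) (r : ℝ) :
    UpperBoundInProbability α Q P X Y μ (networks m (componentwise σ) {n :: ws} r) := by
  have hactc : ∀ n, Continuous (componentwise σ n) := fun n => by
    unfold componentwise; fun_prop
  rw [networks_eq_biUnion]
  refine UpperBoundInProbability.biUnion (Set.finite_singleton _) fun ws' hws' => ?_
  rw [Set.mem_singleton_iff] at hws'
  subst hws'
  have hcont := Architecture.continuous_eval (Architecture.uniform (componentwise σ) n ws)
    (Architecture.continuousActivations_uniform hactc n ws)
  obtain ⟨D, hD⟩ := ((isCompact_closedBall (0 : Fin n → ℝ) C).prod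
    (Architecture.isCompact_paramBox (Architecture.uniform (componentwise σ) n ws) r))
      |>.exists_bound_of_continuousOn hcont.continuousOn
  refine upperBoundInProbability_eval hα0 hα1 hX hY continuous_id _
    (Architecture.continuousActivations_uniform hactc m (n :: ws))
    (Architecture.isCompact_paramBox _ r) (b := fun _ => D) (fun θ hθ x => ?_)
    (integrable_const _) (integrable_const _)
  have hC0 : 0 ≤ C := (abs_nonneg _).trans (hC 0)
  let θ' : (Fin n × Option (Fin m)) ⊕ (Architecture.uniform (componentwise σ) n ws).ParamIdx → ℝ :=
    θ
  refine hD (componentwise σ n fun i => (∑ j, θ' (Sum.inl (i, some j)) * x j) +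
    θ' (Sum.inl (i, none)), fun i => θ' (Sum.inr i)) ⟨?_, fun i => hθ (Sum.inr i)⟩
  rw [mem_closedBall_zero_iff]
  exact (pi_norm_le_iff_of_nonneg hC0).2 fun i => hC _

end EuclideanUpperBound

/-! ### Networks realizing bounded approximations -/

section Density

/-- Density from approximation on compact sets by uniformly bounded functions: by tightness the
complement of a large compact set is negligible. -/
lemma boundedlyDense_of_compact_approximation {E : Type*} [TopologicalSpace E]
    [TopologicalSpace.IsCompletelyPseudoMetrizableSpace E] [SecondCountableTopology E] [T2Space E]
    [MeasurableSpace E] [BorelSpace E] {Q P : Measure E} [IsProbabilityMeasure Q]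
    [IsProbabilityMeasure P] {Φ : ℕ → Set (E → ℝ)}
    (h : ∀ (g : E → ℝ) (B : ℝ), 0 < B → Continuous g → (∀ x, |g x| ≤ B) → ∃ C : ℝ,
      ∀ K : Set E, IsCompact K → ∀ ε : ℝ, 0 < ε → ∃ φ : E → ℝ, Continuous φ ∧ (∀ x, |φ x| ≤ C) ∧
        (∀ x ∈ K, |g x - φ x| ≤ ε) ∧ ∀ᶠ k in atTop, φ ∈ Φ k) :
    BoundedlyDense Q P Φ := by
  intro g B hg hB
  have hne : Nonempty E := nonempty_of_isProbabilityMeasure Q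
  have hB0 : 0 ≤ B := (abs_nonneg _).trans (hB hne.some)
  have hB' : ∀ x, |g x| ≤ B + 1 := fun x => (hB x).trans (by linarith)
  obtain ⟨C, hC⟩ := h g (B + 1) (by linarith) hg hB'
  refine ⟨C, fun η hη => ?_⟩
  obtain ⟨K, hK, hKν⟩ := isTightMeasureSet_iff_exists_isCompact_measure_compl_le.1
    (isTightMeasureSet_singleton (μ := Q + P)) (ENNReal.ofReal (η / (4 * (|C| + B + 1))))
    (by rw [ENNReal.ofReal_pos]; positivity)
  obtain ⟨φ, hφ, hφC, hφK, hφk⟩ := hC K hK (η / 8) (by positivity)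
  refine ⟨φ, hφ, hφC, ?_, hφk⟩
  have hreal : (Q + P).real Kᶜ ≤ η / (4 * (|C| + B + 1)) :=
    ENNReal.toReal_le_of_le_ofReal (by positivity) (hKν _ rfl)
  have hle : ∀ x, |g x - φ x| ≤ η / 8 + Kᶜ.indicator (fun _ => |C| + B + 1) x := fun x => by
    by_cases hx : x ∈ K
    · rw [Set.indicator_of_notMem (by simpa using hx), add_zero]
      exact hφK x hx
    · rw [Set.indicator_of_mem (by simpa using hx)]
      have h1 := (abs_sub (g x) (φ x)).trans (add_le_add (hB x) (hφC x))
      linarith [le_abs_self C]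
  calc ∫ x, |g x - φ x| ∂(Q + P)
      ≤ ∫ x, (η / 8 + Kᶜ.indicator (fun _ => |C| + B + 1) x) ∂(Q + P) :=
        integral_mono_of_nonneg (ae_of_all _ fun _ => abs_nonneg _)
          ((integrable_const _).add ((integrable_const _).indicator hK.measurableSet.compl))
          (ae_of_all _ hle)
    _ = η / 4 + (Q + P).real Kᶜ * (|C| + B + 1) := by
        rw [integral_add (integrable_const _)
          ((integrable_const _).indicator hK.measurableSet.compl),
          integral_indicator hK.measurableSet.compl]
        simp [measureReal_add_apply]
        ring
    _ ≤ η / 4 + η / (4 * (|C| + B + 1)) * (|C| + B + 1) := by gcongr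
    _ = η / 2 := by
        have : |C| + B + 1 ≠ 0 := by positivity
        field_simp
        ring
    _ < η := half_lt_self hη

variable {m : ℕ}

lemma continuous_shallow {σ : ℝ → ℝ} (hσ : Continuous σ) (n : ℕ) (c : ℕ → ℝ) (w : ℕ → Fin m → ℝ)
    (b : ℕ → ℝ) : Continuous (shallow σ n c w b) := by
  unfold shallow
  fun_prop

lemma exists_bound_coefficients (n : ℕ) (c : ℕ → ℝ) (w : ℕ → Fin m → ℝ) (b : ℕ → ℝ) :
    ∃ R : ℝ, 0 ≤ R ∧ ∀ i < n, |c i| ≤ R ∧ |b i| ≤ R ∧ ∀ j, |w i j| ≤ R := by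
  have h0 : ∀ i, 0 ≤ |c i| + |b i| + ∑ j, |w i j| := fun i => by positivity
  refine ⟨∑ i ∈ Finset.range n, (|c i| + |b i| + ∑ j, |w i j|),
    Finset.sum_nonneg fun i _ => h0 i, fun i hi => ?_⟩
  have h1 := Finset.single_le_sum (fun i _ => h0 i) (Finset.mem_range.2 hi)
  have h2 : 0 ≤ ∑ j, |w i j| := by positivity
  refine ⟨?_, ?_, fun j => ?_⟩
  · linarith [abs_nonneg (b i)]
  · linarith [abs_nonneg (c i)]
  · have h3 := Finset.single_le_sum (fun j _ => abs_nonneg (w i j)) (Finset.mem_univ j)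
    linarith [abs_nonneg (b i), abs_nonneg (c i)]

/-- Two hidden layers of width `k`: the first is a padded shallow network, and the second uses a
single unit. -/
lemma eventually_mem_networks_two (σ : ℝ → ℝ) (n : ℕ) (c : ℕ → ℝ) (w : ℕ → Fin m → ℝ)
    (b : ℕ → ℝ) (A D : ℝ) {a : ℕ → ℝ} (ha : Tendsto a atTop atTop) :
    ∀ᶠ k in atTop, (fun x => A * σ (shallow σ n c w b x) + D) ∈
      networks m (componentwise σ) {[k, k]} (a k) := by
  obtain ⟨R, hR0, hR⟩ := exists_bound_coefficients n c w b
  filter_upwards [ha.eventually_ge_atTop (R + |A| + |D|), eventually_ge_atTop n,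
    eventually_ge_atTop 1] with k hk hn h1
  have hkA : |A| ≤ a k := by linarith [abs_nonneg D]
  have hkD : |D| ≤ a k := by linarith [abs_nonneg A]
  have hkR : R ≤ a k := by linarith [abs_nonneg A, abs_nonneg D]
  have hk0 : 0 ≤ a k := hR0.trans hkR
  -- units beyond the first `n`, and beyond the first one in the second layer, get zero weights
  refine ⟨[k, k], rfl, Architecture.consParams
    (fun i j => if (i : ℕ) < n then w i j else 0) (fun i => if (i : ℕ) < n then b i else 0)
    (Architecture.consParams (fun _ j => if (j : ℕ) < n then c j else 0) (fun _ => 0)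
    (Architecture.outParams (fun j => if (j : ℕ) = 0 then A else 0) D)), ?_, ?_⟩
  · refine Architecture.consParams_mem_paramBox (fun i j => ?_) (fun i => ?_)
      (Architecture.consParams_mem_paramBox (fun _ j => ?_) (fun _ => ?_)
      (Architecture.outParams_mem_paramBox (fun j => ?_) hkD))
    · split_ifs with hi
      · exact ((hR i hi).2.2 j).trans hkR
      · simpa using hk0
    · split_ifs with hi
      · exact (hR i hi).2.1.trans hkR
      · simpa using hk0
    · split_ifs with hj
      · exact (hR j hj).1.trans hkR
      · simpa using hk0
    · simpa using hk0
    · split_ifs with hj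
      · exact hkA
      · simpa using hk0
  · funext x
    simp only [Architecture.uniform]
    rw [Architecture.eval_consParams, Architecture.eval_consParams, Architecture.eval_outParams]
    simp only [componentwise, add_zero]
    congr 1
    have hin : ∑ j : Fin k, (if (j : ℕ) < n then c j else 0) *
        σ ((∑ l, (if (j : ℕ) < n then w j l else 0) * x l) + if (j : ℕ) < n then b j else 0) =
        shallow σ n c w b x := by
      rw [Fin.sum_univ_eq_sum_range (fun j => (if j < n then c j else 0) *
        σ ((∑ l, (if j < n then w j l else 0) * x l) + if j < n then b j else 0)) k]
      unfold shallow
      rw [← Finset.sum_subset (Finset.range_mono hn)]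
      · refine Finset.sum_congr rfl fun i hi => ?_
        simp [Finset.mem_range.1 hi]
      · intro i _ hi
        simp only [Finset.mem_range] at hi
        simp [hi]
    rw [hin, Finset.sum_eq_single (⟨0, h1⟩ : Fin k)]
    · simp
    · intro j _ hj
      have : (j : ℕ) ≠ 0 := fun h => hj (Fin.ext h)
      simp [this]
    · simp

/-- The outer `relu` acts on a nonnegative number, so it only serves to supply a third layer. -/
lemma clamp_eq_relu {B : ℝ} (hB : 0 ≤ B) (t : ℝ) :
    max (-B) (min B t) = relu (relu (t + B) - relu (t - B)) - B := by
  unfold relu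
  rcases le_total t (-B) with h | h
  · rw [min_eq_right (by linarith), max_eq_left h, max_eq_right (by linarith : t + B ≤ 0),
      max_eq_right (by linarith : t - B ≤ 0)]
    simp
  · rw [max_eq_left (by linarith : 0 ≤ t + B)]
    rcases le_total B t with h' | h'
    · rw [min_eq_left h', max_eq_right (by linarith), max_eq_left (by linarith : 0 ≤ t - B),
        max_eq_left (by linarith)]
      ring
    · rw [min_eq_right h', max_eq_right h, max_eq_right (by linarith : t - B ≤ 0),
        max_eq_left (by linarith)]
      ring

/-- A clamped shallow ReLU network as a ReLU network with hidden widths `n`, `2`, `1`. -/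
lemma eventually_clamp_mem_networks_relu (n : ℕ) (c : ℕ → ℝ) (w : ℕ → Fin m → ℝ)
    (b : ℕ → ℝ) {B : ℝ} (hB : 0 ≤ B) {a : ℕ → ℝ} (ha : Tendsto a atTop atTop) :
    ∀ᶠ k in atTop, (fun x => max (-B) (min B (shallow relu n c w b x))) ∈
      networks m (componentwise relu) {ws | ws.length = 3 ∧ ∀ w ∈ ws, w ≤ k} (a k) := by
  let θ : (Architecture.uniform (componentwise relu) m [n, 2, 1]).Params :=
    Architecture.consParams (fun i j => w i j) (fun i => b i)
    (Architecture.consParams (fun _ j => c j) ![B, -B]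
    (Architecture.consParams (fun _ => ![1, -1]) (fun _ => 0)
    (Architecture.outParams (fun _ => 1) (-B))))
  filter_upwards [Architecture.eventually_mem_paramBox _ θ ha, eventually_ge_atTop n,
    eventually_ge_atTop 2] with k hθ hn h2
  refine ⟨[n, 2, 1], ⟨rfl, by simp; omega⟩, θ, hθ, ?_⟩
  funext x
  simp only [Architecture.uniform, θ]
  rw [Architecture.eval_consParams, Architecture.eval_consParams, Architecture.eval_consParams,
    Architecture.eval_outParams, clamp_eq_relu hB]
  have hin : ∑ j : Fin n, c j * relu ((∑ l, w j l * x l) + b j) = shallow relu n c w b x :=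
    Fin.sum_univ_eq_sum_range (fun j => c j * relu ((∑ l, w j l * x l) + b j)) n
  simp only [componentwise, hin, Fin.sum_univ_two, Finset.univ_unique, Finset.sum_singleton,
    Matrix.cons_val_zero, Matrix.cons_val_one, one_mul, neg_mul, add_zero, ← sub_eq_add_neg]

lemma sum_range_two_mul (f : ℕ → ℝ) (hf : ∀ i, f (2 * i) = 0) (n : ℕ) :
    ∑ i ∈ Finset.range (2 * n), f i = ∑ i ∈ Finset.range n, f (2 * i + 1) := by
  induction n with
  | zero => simp
  | succ n ih =>
    rw [show 2 * (n + 1) = 2 * n + 1 + 1 by ring, Finset.sum_range_succ, Finset.sum_range_succ,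
      Finset.sum_range_succ, ih, hf, add_zero]

/-- GroupSort applied to pairs `(0, t)` produces `relu t` in the odd coordinates. -/
lemma groupSort_odd {n : ℕ} (y : Fin n → ℝ) {i : ℕ} (hi : 2 * i + 1 < n)
    (h0 : y ⟨2 * i, by omega⟩ = 0) :
    groupSort n y ⟨2 * i + 1, hi⟩ = relu (y ⟨2 * i + 1, hi⟩) := by
  unfold groupSort relu
  rw [if_neg (by simp), max_comm]
  congr 1

/-- A clamped shallow ReLU network as a GroupSort network with hidden widths `2n`, `4`: a pair of
units, one of which is constantly zero, simulates a ReLU unit. -/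
lemma eventually_clamp_mem_networks_groupSort (n : ℕ) (c : ℕ → ℝ) (w : ℕ → Fin m → ℝ)
    (b : ℕ → ℝ) {B : ℝ} (hB : 0 ≤ B) {a : ℕ → ℝ} (ha : Tendsto a atTop atTop) :
    ∀ᶠ k in atTop, (fun x => max (-B) (min B (shallow relu n c w b x))) ∈
      networks m groupSort {ws | ws.length ≤ k ∧ ∀ w ∈ ws, w ≤ k ∧ Even w} (a k) := by
  let θ : (Architecture.uniform groupSort m [2 * n, 4]).Params :=
    Architecture.consParams (fun i j => if (i : ℕ) % 2 = 0 then 0 else w ((i : ℕ) / 2) j)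
      (fun i => if (i : ℕ) % 2 = 0 then 0 else b ((i : ℕ) / 2))
    (Architecture.consParams (fun i j => if (i : ℕ) % 2 = 0 ∨ (j : ℕ) % 2 = 0 then 0 else
      c ((j : ℕ) / 2)) ![0, B, 0, -B]
    (Architecture.outParams ![0, 1, 0, -1] (-B)))
  filter_upwards [Architecture.eventually_mem_paramBox _ θ ha, eventually_ge_atTop (2 * n),
    eventually_ge_atTop 4] with k hθ hn h4
  refine ⟨[2 * n, 4], ⟨by simp; omega, ?_⟩, θ, hθ, ?_⟩
  · intro v hv
    simp only [List.mem_cons, List.not_mem_nil, or_false] at hv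
    rcases hv with rfl | rfl
    · exact ⟨hn, even_two_mul n⟩
    · exact ⟨h4, by decide⟩
  funext x
  simp only [Architecture.uniform, θ]
  rw [Architecture.eval_consParams, Architecture.eval_consParams, Architecture.eval_outParams]
  -- `y` is the first layer before sorting: the pairs `(0, w i · x + b i)`
  set y : Fin (2 * n) → ℝ := fun i =>
    (∑ j, (if (i : ℕ) % 2 = 0 then 0 else w ((i : ℕ) / 2) j) * x j) +
      if (i : ℕ) % 2 = 0 then 0 else b ((i : ℕ) / 2) with hy
  have hin : ∑ j : Fin (2 * n), (if (j : ℕ) % 2 = 0 then 0 else c ((j : ℕ) / 2)) *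
      groupSort (2 * n) y j = shallow relu n c w b x := by
    have h1 : ∀ j : Fin (2 * n), (if (j : ℕ) % 2 = 0 then 0 else c ((j : ℕ) / 2)) *
        groupSort (2 * n) y j = (fun j : ℕ => if j % 2 = 0 then 0 else c (j / 2) *
          relu ((∑ l, w (j / 2) l * x l) + b (j / 2))) j := by
      rintro ⟨j, hj⟩
      rcases Nat.even_or_odd' j with ⟨i, rfl | rfl⟩
      · simp
      · have e1 : (2 * i + 1) % 2 = 1 := by omega
        have e2 : (2 * i + 1) / 2 = i := by omega
        rw [groupSort_odd y hj (by simp [hy])]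
        simp [hy, e1, e2]
    rw [Finset.sum_congr rfl fun j _ => h1 j, Fin.sum_univ_eq_sum_range (fun j : ℕ =>
      if j % 2 = 0 then 0 else c (j / 2) * relu ((∑ l, w (j / 2) l * x l) + b (j / 2))),
      sum_range_two_mul _ (fun i => by simp)]
    unfold shallow
    refine Finset.sum_congr rfl fun i _ => ?_
    have e1 : (2 * i + 1) % 2 = 1 := by omega
    have e2 : (2 * i + 1) / 2 = i := by omega
    simp [e1, e2]
  -- `z` is the second layer before sorting: the pairs `(0, s + B)` and `(0, s - B)`, where `s` is
  -- the shallow network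
  set z : Fin 4 → ℝ := fun i => (∑ j : Fin (2 * n),
    (if (i : ℕ) % 2 = 0 ∨ (j : ℕ) % 2 = 0 then 0 else c ((j : ℕ) / 2)) * groupSort (2 * n) y j) +
      (![0, B, 0, -B] : Fin 4 → ℝ) i with hz
  have z0 : z 0 = 0 := by simp [hz]
  have z1 : z 1 = shallow relu n c w b x + B := by rw [← hin]; simp [hz]
  have z2 : z 2 = 0 := by simp [hz]
  have z3 : z 3 = shallow relu n c w b x - B := by rw [← hin, sub_eq_add_neg]; simp [hz]
  have g1 : groupSort 4 z 1 = relu (z 1) := groupSort_odd z (i := 0) (by norm_num) z0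
  have g3 : groupSort 4 z 3 = relu (z 3) := groupSort_odd z (i := 1) (by norm_num) z2
  rw [Fin.sum_univ_four, g1, g3, z1, z3, clamp_eq_relu hB]
  have hpos : 0 ≤ relu (shallow relu n c w b x + B) - relu (shallow relu n c w b x - B) := by
    unfold relu
    exact sub_nonneg.2 (max_le_max (by linarith) le_rfl)
  rw [show relu (relu (shallow relu n c w b x + B) - relu (shallow relu n c w b x - B)) = _ from
    max_eq_left hpos]
  simp
  ring

/-- Universal approximation by shallow ReLU networks, from the bounded activation
`t ↦ relu t - relu (t - 1)`. -/
lemma exists_shallow_relu_close {K : Set (Fin m → ℝ)} (hK : IsCompact K) {g : (Fin m → ℝ) → ℝ}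
    (hg : ContinuousOn g K) {ε : ℝ} (hε : 0 < ε) :
    ∃ n c w b, ∀ x ∈ K, |g x - shallow relu n c w b x| < ε := by
  have hbound : ∀ t, |relu t - relu (t - 1)| ≤ 1 := fun t => by
    unfold relu
    rw [abs_le]
    rcases max_cases t 0 with ⟨h, _⟩ | ⟨h, _⟩ <;>
      rcases max_cases (t - 1) 0 with ⟨h', _⟩ | ⟨h', _⟩ <;>
      rw [h, h'] <;> constructor <;> linarith
  obtain ⟨n, c, w, b, h⟩ := exists_shallow_close (σ := fun t => relu t - relu (t - 1))
    (by unfold relu; fun_prop) hbound (s := 0) (t := 1) (by norm_num [relu]) hK hg hε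
  refine ⟨n + n, fun i => if i < n then c i else -c (i - n),
    fun i => if i < n then w i else w (i - n),
    fun i => if i < n then b i else b (i - n) - 1, fun x hx => ?_⟩
  refine lt_of_eq_of_lt ?_ (h x hx)
  congr 2
  unfold shallow
  rw [Finset.sum_range_add, ← Finset.sum_add_distrib]
  refine Finset.sum_congr rfl fun i hi => ?_
  have hi' := Finset.mem_range.1 hi
  simp only [hi', if_true, add_tsub_cancel_left, not_lt.2 (Nat.le_add_right n i), if_false]
  rw [add_sub_assoc]
  ring

variable {Q P : Measure (Fin m → ℝ)} [IsProbabilityMeasure Q] [IsProbabilityMeasure P]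

/-- Spaces that eventually contain every clamped shallow ReLU network are boundedly dense. -/
lemma boundedlyDense_of_clamp_mem {Φ : ℕ → Set ((Fin m → ℝ) → ℝ)}
    (h : ∀ (n : ℕ) (c : ℕ → ℝ) (w : ℕ → Fin m → ℝ) (b : ℕ → ℝ) (B : ℝ), 0 ≤ B → ∀ᶠ k in atTop,
      (fun x => max (-B) (min B (shallow relu n c w b x))) ∈ Φ k) :
    BoundedlyDense Q P Φ := by
  refine boundedlyDense_of_compact_approximation fun g B hB0 hg hB => ⟨B, fun K hK ε hε => ?_⟩
  obtain ⟨n, c, w, b, hclose⟩ := exists_shallow_relu_close hK hg.continuousOn hε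
  have hc : Continuous (shallow relu n c w b) :=
    continuous_shallow (by unfold relu; fun_prop) n c w b
  exact ⟨_, by fun_prop, fun x => abs_clamp_le hB0.le,
    fun x hx => (abs_sub_clamp_le (hB x)).trans (hclose x hx).le, h n c w b B hB0.le⟩

/-- A continuous function with values in `σ [c, d]` lifts through a continuous injective `σ`. -/
lemma exists_continuous_lift {E : Type*} [TopologicalSpace E] {σ : ℝ → ℝ} (hσ : Continuous σ)
    {c d : ℝ} (hinj : Set.InjOn σ (Set.Icc c d)) {τ : E → ℝ} (hτ : Continuous τ)
    (hmem : ∀ x, τ x ∈ σ '' Set.Icc c d) :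
    ∃ h : E → ℝ, Continuous h ∧ (∀ x, h x ∈ Set.Icc c d) ∧ ∀ x, σ (h x) = τ x := by
  choose h hh hστ using hmem
  let σ' : Set.Icc c d → ℝ := fun t => σ t
  have hemb : Topology.IsClosedEmbedding σ' :=
    Continuous.isClosedEmbedding (by fun_prop) fun s t hst => Subtype.ext (hinj s.2 t.2 hst)
  have hc : Continuous fun x => (⟨h x, hh x⟩ : Set.Icc c d) := by
    rw [hemb.isEmbedding.continuous_iff]
    convert hτ using 1
    funext x
    exact hστ x
  exact ⟨h, continuous_subtype_val.comp hc, hh, hστ⟩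

/-- Two hidden layers with a bounded activation that is injective on an interval: a bounded
function `g` is `A σ(h) + D` with `h` continuous, and approximating `h` by a shallow network keeps
the result globally bounded by `|A| sup |σ| + |D|`. -/
lemma boundedlyDense_networks_two {σ : ℝ → ℝ} (hσ : Continuous σ) {M : ℝ} (hM : ∀ t, |σ t| ≤ M)
    {c d : ℝ} (hcd : c < d) (hinj : Set.InjOn σ (Set.Ioo c d)) {a : ℕ → ℝ}
    (ha : Tendsto a atTop atTop) :
    BoundedlyDense Q P (fun k => networks m (componentwise σ) {[k, k]} (a k)) := by
  refine boundedlyDense_of_compact_approximation fun g B hB0 hg hB => ?_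
  obtain ⟨c', hc, hc'⟩ := exists_between hcd
  obtain ⟨d', hd, hd'⟩ := exists_between hc'
  have hsub : Set.Icc c' d' ⊆ Set.Ioo c d := fun t ht => ⟨hc.trans_le ht.1, ht.2.trans_lt hd'⟩
  have hinj' := hinj.mono hsub
  have hne : σ c' ≠ σ d' := fun h => hd.ne
    (hinj' (Set.left_mem_Icc.2 hd.le) (Set.right_mem_Icc.2 hd.le) h)
  set e := σ c' with he
  set f := σ d' with hf
  have hfe : f - e ≠ 0 := sub_ne_zero.2 hne.symm
  -- rescale `g` from `[-B, B]` to the interval between `σ c'` and `σ d'`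
  let τ : (Fin m → ℝ) → ℝ := fun x => e + (g x + B) / (2 * B) * (f - e)
  have hτmem : ∀ x, τ x ∈ σ '' Set.Icc c' d' := fun x => by
    have h1 : Set.uIcc e f ⊆ σ '' Set.Icc c' d' := by
      have := intermediate_value_uIcc (a := c') (b := d') hσ.continuousOn
      rwa [Set.uIcc_of_le hd.le] at this
    refine h1 ?_
    rw [← segment_eq_uIcc, segment_eq_image']
    refine ⟨(g x + B) / (2 * B), ⟨?_, ?_⟩, rfl⟩
    · have := (abs_le.1 (hB x)).1
      exact div_nonneg (by linarith) (by linarith)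
    · rw [div_le_one (by linarith)]
      linarith [(abs_le.1 (hB x)).2]
  obtain ⟨h, hh, hhmem, hστ⟩ := exists_continuous_lift hσ hinj' (τ := τ) (by fun_prop) hτmem
  set A := 2 * B / (f - e) with hA
  set D := -B - A * e with hD
  have hgA : ∀ x, g x = A * σ (h x) + D := fun x => by
    rw [hστ, hD, hA]
    simp only [τ]
    field_simp
    ring
  refine ⟨|A| * M + |D|, fun K hK ε hε => ?_⟩
  have huc : UniformContinuousOn σ (Set.Icc (c' - 1) (d' + 1)) :=
    isCompact_Icc.uniformContinuousOn_of_continuous hσ.continuousOn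
  obtain ⟨δ, hδ, hδε⟩ := Metric.uniformContinuousOn_iff.1 huc (ε / (|A| + 1)) (by positivity)
  obtain ⟨n, cc, w, b, hclose⟩ := exists_shallow_close hσ hM hne hK hh.continuousOn
    (ε := min δ 1) (by positivity)
  have hsc : Continuous (shallow σ n cc w b) := continuous_shallow hσ n cc w b
  refine ⟨fun x => A * σ (shallow σ n cc w b x) + D, by fun_prop, fun x => ?_, fun x hx => ?_,
    eventually_mem_networks_two σ n cc w b A D ha⟩
  · refine (abs_add_le _ _).trans ?_
    rw [abs_mul]
    gcongr
    exact hM _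
  · obtain ⟨h1, h2⟩ := lt_min_iff.1 (hclose x hx)
    obtain ⟨h3, h4⟩ := abs_lt.1 h2
    have h5 := hδε (h x) ⟨by linarith [(hhmem x).1], by linarith [(hhmem x).2]⟩
      (shallow σ n cc w b x) ⟨by linarith [(hhmem x).1], by linarith [(hhmem x).2]⟩
      (by rwa [Real.dist_eq])
    rw [Real.dist_eq] at h5
    rw [hgA, show A * σ (h x) + D - (A * σ (shallow σ n cc w b x) + D) =
      A * (σ (h x) - σ (shallow σ n cc w b x)) by ring, abs_mul]
    calc |A| * |σ (h x) - σ (shallow σ n cc w b x)| ≤ (|A| + 1) * (ε / (|A| + 1)) := by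
          gcongr
          linarith
      _ = ε := mul_div_cancel₀ _ (by positivity)

/-- On a compact domain the universal approximation property gives uniform approximation. -/
lemma boundedlyDense_of_universalApproximation {Ω : Set (Fin m → ℝ)} (hΩ : IsCompact Ω)
    {Q P : Measure Ω} [IsProbabilityMeasure Q] [IsProbabilityMeasure P] {F : NetworkFamily m}
    (hF : UniversalApproximation F.functions) {a : ℕ → ℝ} (ha : Tendsto a atTop atTop) :
    BoundedlyDense Q P
      (fun k => (fun (φ : (Fin m → ℝ) → ℝ) (x : Ω) => φ x) '' F.bounded k (a k)) := by
  have : CompactSpace Ω := isCompact_iff_compactSpace.1 hΩ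
  have : CompleteSpace Ω := hΩ.isComplete.completeSpace_coe
  refine boundedlyDense_of_compact_approximation fun g B hB0 hg hB => ⟨B + 1, fun K hK ε hε => ?_⟩
  obtain ⟨G, hG⟩ := ContinuousMap.exists_restrict_eq hΩ.isClosed (⟨g, hg⟩ : C(Ω, ℝ))
  have hGg : ∀ x : Ω, G x = g x := fun x => congrArg (fun f : C(Ω, ℝ) => f x) hG
  obtain ⟨_, ⟨A, hA, θ, hθ, rfl⟩, hclose⟩ := hF G G.continuous (min ε 1) (by positivity) Ω hΩ
  refine ⟨fun x => A.eval θ x, ?_, fun x => ?_, fun x _ => ?_, ?_⟩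
  · exact (A.continuous_eval (F.continuous_activations A hA)).comp
      (continuous_subtype_val.prodMk continuous_const)
  · have h1 := (hclose x x.2).trans_le (min_le_right _ _)
    rw [hGg] at h1
    have h2 := abs_le.1 (hB x)
    have h3 := abs_lt.1 h1
    exact abs_le.2 ⟨by linarith, by linarith⟩
  · have h1 := (hclose x x.2).trans_le (min_le_left _ _)
    rw [hGg] at h1
    exact h1.le
  · have hw : ∀ᶠ k in atTop, ∀ w ∈ A.widths, w ≤ k := by
      refine (eventually_ge_atTop A.widths.sum).mono fun k hk w hw => ?_
      exact (List.single_le_sum (fun _ _ => Nat.zero_le _) w hw).trans hk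
    filter_upwards [A.eventually_mem_paramBox θ ha, eventually_ge_atTop A.depth, hw] with k h1 h2 h3
    exact ⟨A.eval θ, ⟨A, hA, h2, h3, θ, ⟨hθ, h1⟩, rfl⟩, rfl⟩

end Density

section Activations

lemma norm_componentwise_relu_le (n : ℕ) (x : Fin n → ℝ) : ‖componentwise relu n x‖ ≤ ‖x‖ := by
  refine (pi_norm_le_iff_of_nonneg (norm_nonneg _)).2 fun i => ?_
  refine le_trans ?_ (norm_le_pi_norm x i)
  rw [Real.norm_eq_abs, Real.norm_eq_abs]
  simp only [componentwise, relu]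
  exact abs_max_le_max_abs_abs.trans (by simp)

lemma norm_groupSort_le (n : ℕ) (x : Fin n → ℝ) : ‖groupSort n x‖ ≤ ‖x‖ := by
  refine (pi_norm_le_iff_of_nonneg (norm_nonneg _)).2 fun i => ?_
  have h : ∀ j, |x j| ≤ ‖x‖ := norm_le_pi_norm x
  rw [Real.norm_eq_abs]
  unfold groupSort
  split_ifs
  · exact abs_min_le_max_abs_abs.trans (max_le (h _) (h _))
  · exact h _
  · exact abs_max_le_max_abs_abs.trans (max_le (h _) (h _))

lemma continuous_groupSort (n : ℕ) : Continuous (groupSort n) := by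
  refine continuous_pi fun i => ?_
  unfold groupSort
  split_ifs <;> fun_prop

lemma continuous_componentwise_relu (n : ℕ) : Continuous (componentwise relu n) := by
  unfold componentwise relu
  fun_prop

lemma networks_mono {m : ℕ} {act : (n : ℕ) → (Fin n → ℝ) → (Fin n → ℝ)} {W W' : Set (List ℕ)}
    (h : W ⊆ W') (r : ℝ) : networks m act W r ⊆ networks m act W' r := by
  rintro φ ⟨ws, hws, h'⟩
  exact ⟨ws, h hws, h'⟩

end Activations

/-! ### Consistency of the network estimators -/

section NetworkFamily

variable {α : ℝ} {m : ℕ} {N : Type*} [MeasurableSpace N] {μ : Measure N} [IsProbabilityMeasure μ]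

lemma isConsistent_networkFamily (hα0 : α ≠ 0) (hα1 : α ≠ 1) {a : ℕ → ℝ}
    (ha : Tendsto a atTop atTop) {Ω : Set (Fin m → ℝ)} (hΩ : IsCompact Ω) {Q P : Measure Ω}
    [IsProbabilityMeasure Q] [IsProbabilityMeasure P] {F : NetworkFamily m}
    (hF : UniversalApproximation F.functions) {X Y : ℕ → N → Ω} (hX : IsIIDSample X Q μ)
    (hY : IsIIDSample Y P μ) :
    IsConsistent α Q P
      (fun k => (fun (φ : (Fin m → ℝ) → ℝ) (x : Ω) => φ x) '' F.bounded k (a k)) X Y μ := by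
  have : CompactSpace Ω := isCompact_iff_compactSpace.1 hΩ
  refine isConsistent_of_boundedlyDense hα0 hα1 hX hY
    (boundedlyDense_of_universalApproximation hΩ hF ha) fun k => ?_
  refine (UpperBoundInProbability.biUnion (F.finite_archs k)
    (S := fun A => {φ | ∃ θ ∈ F.params A ∩ A.paramBox (a k), φ = fun x : Ω => A.eval θ x})
    fun A hA => ?_).mono ?_
  · exact upperBoundInProbability_eval_of_compactSpace hα0 hα1 hX hY continuous_subtype_val A
      (F.continuous_activations A hA.1)
      ((A.isCompact_paramBox (a k)).inter_left (F.isClosed_params A hA.1))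
  · rintro _ ⟨_, ⟨A, hA, h1, h2, θ, hθ, rfl⟩, rfl⟩
    exact Set.mem_biUnion (show A ∈ _ from ⟨hA, h1, h2⟩) ⟨θ, hθ, rfl⟩

end NetworkFamily

section Euclidean

variable {α : ℝ} {m : ℕ} {N : Type*} [MeasurableSpace N] {μ : Measure N} [IsProbabilityMeasure μ]
  {Q P : Measure (Fin m → ℝ)} [IsProbabilityMeasure Q] [IsProbabilityMeasure P]
  {X Y : ℕ → N → Fin m → ℝ} {a : ℕ → ℝ}

lemma isConsistent_networks_two (hα0 : α ≠ 0) (hα1 : α ≠ 1) (ha : Tendsto a atTop atTop)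
    {σ : ℝ → ℝ} (hσ : Continuous σ) {C : ℝ} (hC : ∀ t, |σ t| ≤ C) {c d : ℝ} (hcd : c < d)
    (hinj : Set.InjOn σ (Set.Ioo c d)) (hX : IsIIDSample X Q μ) (hY : IsIIDSample Y P μ) :
    IsConsistent α Q P (fun k => networks m (componentwise σ) {[k, k]} (a k)) X Y μ :=
  isConsistent_of_boundedlyDense hα0 hα1 hX hY (boundedlyDense_networks_two hσ hC hcd hinj ha)
    fun k => upperBoundInProbability_networks_of_bounded hα0 hα1 hX hY hσ hC k [k] (a k)

lemma isConsistent_networks_relu_three (hα0 : α ≠ 0) (hα1 : α ≠ 1) (ha : Tendsto a atTop atTop)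
    (hQ : FiniteMGF Q) (hP : FiniteMGF P) (hX : IsIIDSample X Q μ) (hY : IsIIDSample Y P μ) :
    IsConsistent α Q P (fun k => networks m (componentwise relu)
      {ws | ws.length = 3 ∧ ∀ w ∈ ws, w ≤ k} (a k)) X Y μ := by
  refine isConsistent_of_boundedlyDense hα0 hα1 hX hY (boundedlyDense_of_clamp_mem
    fun n c w b B hB => eventually_clamp_mem_networks_relu n c w b hB ha) fun k => ?_
  refine upperBoundInProbability_networks_of_finiteMGF hα0 hα1 hX hY hQ hP
    continuous_componentwise_relu norm_componentwise_relu_le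
    ((finite_lists_le (max k 3)).subset ?_) (a k)
  rintro ws ⟨h1, h2⟩
  exact ⟨h1.le.trans (le_max_right _ _), fun w hw => (h2 w hw).trans (le_max_left _ _)⟩

lemma isConsistent_networks_relu (hα0 : α ≠ 0) (hα1 : α ≠ 1) (ha : Tendsto a atTop atTop)
    (hQ : FiniteMGF Q) (hP : FiniteMGF P) (hX : IsIIDSample X Q μ) (hY : IsIIDSample Y P μ) :
    IsConsistent α Q P (fun k => networks m (componentwise relu)
      {ws | ws.length ≤ k ∧ ∀ w ∈ ws, w ≤ k} (a k)) X Y μ := by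
  refine isConsistent_of_boundedlyDense hα0 hα1 hX hY (boundedlyDense_of_clamp_mem
    fun n c w b B hB => ?_) fun k => upperBoundInProbability_networks_of_finiteMGF hα0 hα1 hX hY
      hQ hP continuous_componentwise_relu norm_componentwise_relu_le (finite_lists_le k) (a k)
  filter_upwards [eventually_clamp_mem_networks_relu n c w b hB ha, eventually_ge_atTop 3]
    with k hk h3
  have hsub : {ws : List ℕ | ws.length = 3 ∧ ∀ w ∈ ws, w ≤ k} ⊆
      {ws | ws.length ≤ k ∧ ∀ w ∈ ws, w ≤ k} := fun ws hws => ⟨hws.1.le.trans h3, hws.2⟩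
  exact networks_mono hsub _ hk

lemma isConsistent_networks_groupSort (hα0 : α ≠ 0) (hα1 : α ≠ 1) (ha : Tendsto a atTop atTop)
    (hQ : FiniteMGF Q) (hP : FiniteMGF P) (hX : IsIIDSample X Q μ) (hY : IsIIDSample Y P μ) :
    IsConsistent α Q P (fun k => networks m groupSort
      {ws | ws.length ≤ k ∧ ∀ w ∈ ws, w ≤ k ∧ Even w} (a k)) X Y μ :=
  isConsistent_of_boundedlyDense hα0 hα1 hX hY (boundedlyDense_of_clamp_mem
    fun n c w b _ hB => eventually_clamp_mem_networks_groupSort n c w b hB ha)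
    fun k => upperBoundInProbability_networks_of_finiteMGF hα0 hα1 hX hY hQ hP
      continuous_groupSort norm_groupSort_le
      ((finite_lists_le k).subset fun _ hws => ⟨hws.1, fun w hw => (hws.2 w hw).1⟩) (a k)

end Euclidean

end RenyiNN

end

theorem mainTheorem7 (α : ℝ) (hα0 : α ≠ 0) (hα1 : α ≠ 1) (m : ℕ)
    (a : ℕ → ℝ) (ha_mono : Monotone a) (ha_lim : Tendsto a atTop atTop)
    {N : Type*} [MeasurableSpace N] (μ : Measure N) [IsProbabilityMeasure μ] :
    -- compact domain, any network family with the universal approximation property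
    (∀ (Ω : Set (Fin m → ℝ)), IsCompact Ω →
      ∀ (Q P : Measure Ω) [IsProbabilityMeasure Q] [IsProbabilityMeasure P]
        (F : RenyiNN.NetworkFamily m), RenyiNN.UniversalApproximation F.functions →
      ∀ X Y : ℕ → N → Ω, RenyiNN.IsIIDSample X Q μ → RenyiNN.IsIIDSample Y P μ →
        RenyiNN.IsConsistent α Q P
          (fun k => (fun (φ : (Fin m → ℝ) → ℝ) (x : Ω) => φ x) '' F.bounded k (a k)) X Y μ) ∧
    -- two hidden layers of width `k`, bounded activation
    (∀ (σ : ℝ → ℝ), Continuous σ → (∃ C : ℝ, ∀ t, |σ t| ≤ C) →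
      (∃ c d : ℝ, c < d ∧ Set.InjOn σ (Set.Ioo c d) ∧
        ∃ L : ℝ≥0, LipschitzOnWith L σ (Set.Ioo c d)) →
      ∀ (Q P : Measure (Fin m → ℝ)) [IsProbabilityMeasure Q] [IsProbabilityMeasure P]
        (X Y : ℕ → N → Fin m → ℝ), RenyiNN.IsIIDSample X Q μ → RenyiNN.IsIIDSample Y P μ →
        RenyiNN.IsConsistent α Q P
          (fun k => RenyiNN.networks m (RenyiNN.componentwise σ) {[k, k]} (a k)) X Y μ) ∧
    -- ReLU or GroupSort activation
    (∀ (Q P : Measure (Fin m → ℝ)) [IsProbabilityMeasure Q] [IsProbabilityMeasure P],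
      RenyiNN.FiniteMGF Q → RenyiNN.FiniteMGF P →
      RenyiNN.HasLocallyBoundedDensity Q → RenyiNN.HasLocallyBoundedDensity P →
      ∀ X Y : ℕ → N → Fin m → ℝ, RenyiNN.IsIIDSample X Q μ → RenyiNN.IsIIDSample Y P μ →
        -- ReLU, depth and widths at most `k`
        RenyiNN.IsConsistent α Q P
          (fun k => RenyiNN.networks m (RenyiNN.componentwise RenyiNN.relu)
            {ws | ws.length ≤ k ∧ ∀ w ∈ ws, w ≤ k} (a k)) X Y μ ∧
        -- ReLU, exactly three hidden layers, widths at most `k`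
        RenyiNN.IsConsistent α Q P
          (fun k => RenyiNN.networks m (RenyiNN.componentwise RenyiNN.relu)
            {ws | ws.length = 3 ∧ ∀ w ∈ ws, w ≤ k} (a k)) X Y μ ∧
        -- GroupSort with group size 2, depth and (even) widths at most `k`
        RenyiNN.IsConsistent α Q P
          (fun k => RenyiNN.networks m RenyiNN.groupSort
            {ws | ws.length ≤ k ∧ ∀ w ∈ ws, w ≤ k ∧ Even w} (a k)) X Y μ) := by
  refine ⟨fun Ω hΩ Q P _ _ F hF X Y hX hY =>
      RenyiNN.isConsistent_networkFamily hα0 hα1 ha_lim hΩ hF hX hY,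
    fun σ hσ ⟨C, hC⟩ ⟨c, d, hcd, hinj, _⟩ Q P _ _ X Y hX hY =>
      RenyiNN.isConsistent_networks_two hα0 hα1 ha_lim hσ hC hcd hinj hX hY,
    fun Q P _ _ hQ hP _ _ X Y hX hY => ⟨?_, ?_, ?_⟩⟩
  · exact RenyiNN.isConsistent_networks_relu hα0 hα1 ha_lim hQ hP hX hY
  · exact RenyiNN.isConsistent_networks_relu_three hα0 hα1 ha_lim hQ hP hX hY
  · exact RenyiNN.isConsistent_networks_groupSort hα0 hα1 ha_lim hQ hP hX hY
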